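/- **Sublinear-time spectral density estimation for normalized Laplacians.** There are a randomized algorithm and absolute constants $C, k$ such that the following holds for every unweighted, undirected simple graph $G$ on $n\ge 1$ vertices $\{0,\dots,n-1\}$ without isolated vertices and all $\epsilon,\delta\in(0,1)$. Let $A$ be the adjacency matrix of $G$, $D$ the diagonal matrix of its degrees, $\bar A=D^{-1/2}AD^{-1/2}$ the normalized adjacency matrix, $\bar L=I-\bar A$ the normalized Laplacian with eigenvalues $\lambda_1,\dots,\lambda_n\in[0,2]$ (with multiplicity), and $s=\frac1n\sum_{i=1}^n\delta_{\lambda_i}$ its spectral density. The algorithm is one fixed program of a randomized real random access machine: exact real arithmetic $+,-,\times,/,\sqrt{\cdot}$ and comparisons, addition, truncated subtraction and comparison of natural numbers used as counters and addresses, and fair coin flips, in unit time per operation. It receives $n,\epsilon,\delta$ and can (1) sample a uniformly random vertex in constant time, (2) sample a uniformly random neighbor of any given vertex $i$ in constant time, (3) read off all neighbors of a vertex $i$, in an arbitrary order, in time $O(d_i)$, where $d_i$ is the degree of $i$, and read $d_i$ in constant time. The expected running time of the algorithm is at most $$ C\,n\left(\frac{1+\log(1/\delta)}{\epsilon}\right)^{k}.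 $$ With probability $1$ it halts and outputs a probability density function $q:[0,2]\to\mathbb R_{\ge 0}$, given by a finite list of coefficients $c_0,\dots,c_{m-1}$ such that $$ q(x)=p(1-x),\qquad p(y)=\frac{1}{\pi\sqrt{1-y^2}}\sum_{j<m}c_j\,T_j(y), $$ with $T_j$ the Chebyshev polynomials of the first kind, and with probability at least $1-\delta$ $$ W_1(q,s)=\sup_{f:\mathbb R\to\mathbb R\ \text{1-Lipschitz}}\left(\int_0^2 f(x)q(x)\,dx-\frac1n\sum_{i=1}^n f(\lambda_i)\right)\le\epsilon. $$ -/

import Mathlib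

open MeasureTheory
open scoped ENNReal

namespace SDE

/-! ## Normalized Laplacian, spectral density, Wasserstein-1 distance -/

section Spectra

open Classical in
/-- The normalized adjacency matrix `D^{-1/2} A D^{-1/2}` of a graph. -/
noncomputable def normalizedAdjacency {n : ℕ} (G : SimpleGraph (Fin n)) :
    Matrix (Fin n) (Fin n) ℝ :=
  Matrix.diagonal (fun i => (Real.sqrt (G.degree i))⁻¹) * G.adjMatrix ℝ *
    Matrix.diagonal (fun i => (Real.sqrt (G.degree i))⁻¹)

/-- The normalized Laplacian `I - D^{-1/2} A D^{-1/2}` of a graph. -/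
noncomputable def normalizedLaplacian {n : ℕ} (G : SimpleGraph (Fin n)) :
    Matrix (Fin n) (Fin n) ℝ :=
  1 - normalizedAdjacency G

theorem normalizedLaplacian_isHermitian {n : ℕ} (G : SimpleGraph (Fin n)) :
    (normalizedLaplacian G).IsHermitian := by
  classical
  unfold normalizedLaplacian
  refine Matrix.isHermitian_one.sub ?_
  unfold Matrix.IsHermitian normalizedAdjacency
  ext i j
  simp only [Matrix.conjTranspose_apply, Matrix.mul_diagonal, Matrix.diagonal_mul,
    SimpleGraph.adjMatrix_apply, G.adj_comm j i, star_trivial]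
  ring

/-- The spectral density of a Hermitian matrix: the uniform distribution
`(1/n) ∑ i, δ_{λ i}` on its eigenvalues (with multiplicity). -/
noncomputable def spectralMeasure {n : ℕ} {M : Matrix (Fin n) (Fin n) ℝ}
    (hM : M.IsHermitian) : Measure ℝ :=
  (n : ℝ≥0∞)⁻¹ • ∑ i, Measure.dirac (hM.eigenvalues i)

/-- The Wasserstein-1 distance in its dual form: the supremum over all 1-Lipschitz `f` of
`∫ f dμ - ∫ f dν`. Negative values are cut off at `0`, which changes nothing because `f` may be
replaced by `-f`. Used for compactly supported probability measures only, for which every such `f`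
is integrable. -/
noncomputable def W1 (μ ν : Measure ℝ) : ℝ≥0∞ :=
  ⨆ (f : ℝ → ℝ) (_ : LipschitzWith 1 f), ENNReal.ofReal ((∫ x, f x ∂μ) - ∫ x, f x ∂ν)

/-- `q` is a probability density function on `[0, 2]`. -/
def IsDensity (q : ℝ → ℝ) : Prop :=
  Measurable q ∧ (∀ x ∈ Set.Icc (0 : ℝ) 2, 0 ≤ q x) ∧
    ∫⁻ x in Set.Icc (0 : ℝ) 2, ENNReal.ofReal (q x) = 1

/-- The measure on `[0, 2]` with density `q` with respect to Lebesgue measure. -/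
noncomputable def densityMeasure (q : ℝ → ℝ) : Measure ℝ :=
  (volume.restrict (Set.Icc (0 : ℝ) 2)).withDensity fun x => ENNReal.ofReal (q x)

/-- The function `x ↦ p (1 - x)` on `[0, 2]`, where `p` is the function
`y ↦ (∑ k < m, c k * T_k y) / (π * √(1 - y²))` on `[-1, 1]` and `T_k` is the `k`-th Chebyshev
polynomial of the first kind. The list `c 0, …, c (m - 1)` is the finite description by which
an algorithm outputs this function. -/
noncomputable def chebyshevDensity (m : ℕ) (c : ℕ → ℝ) (x : ℝ) : ℝ :=
  (∑ k ∈ Finset.range m, c k * (Polynomial.Chebyshev.T ℝ (k : ℤ)).eval (1 - x)) /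
    (Real.pi * Real.sqrt (1 - (1 - x) ^ 2))

end Spectra

/-! ## Access to the graph -/

/-- An adjacency list representation of a graph; the order of each list is arbitrary. -/
structure AdjList {n : ℕ} (G : SimpleGraph (Fin n)) where
  nbrs : Fin n → List (Fin n)
  nodup : ∀ i, (nbrs i).Nodup
  mem_iff : ∀ i j, j ∈ nbrs i ↔ G.Adj i j

/-- The neighbors of vertex number `v`, as natural numbers; numbers `v ≥ n` are not vertices and
have no neighbors. -/
def AdjList.lookup {n : ℕ} {G : SimpleGraph (Fin n)} (L : AdjList G) (v : ℕ) : List ℕ :=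
  if h : v < n then (L.nbrs ⟨v, h⟩).map Fin.val else []

/-! ## A randomized real random access machine with access to a graph

A program is one fixed text. Memory consists of natural-number variables and arrays (for counters,
vertices and addresses) and of real variables and arrays. Natural numbers can be added,
subtracted (truncated at `0`) and compared, reals admit `+ - * / √` and comparison, and a natural
number may be converted to a real, but not conversely (no rounding). -/

namespace RAM

/-- Memory: variables `ivar x`, `rvar x` and arrays `iarr a`, `rarr a` indexed by `ℕ`. -/
structure State where
  ivar : ℕ → ℕ
  rvar : ℕ → ℝ
  iarr : ℕ → ℕ → ℕ
  rarr : ℕ → ℕ → ℝ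

/-- Natural-number expressions; `get a e` reads entry `e` of array `a`. -/
inductive IExp where
  | const (m : ℕ)
  | var (x : ℕ)
  | get (a : ℕ) (e : IExp)
  | add (e f : IExp)
  | sub (e f : IExp)

/-- Real expressions. The only constants in a program text are rational. -/
inductive RExp where
  | const (q : ℚ)
  | var (x : ℕ)
  | get (a : ℕ) (e : IExp)
  | ofNat (e : IExp)
  | add (e f : RExp)
  | sub (e f : RExp)
  | mul (e f : RExp)
  | div (e f : RExp)
  | sqrt (e : RExp)

/-- Tests: strict comparison of naturals, strict comparison of reals, Boolean combinations. -/
inductive BExp where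
  | ilt (e f : IExp)
  | rlt (e f : RExp)
  | not (b : BExp)
  | and (b c : BExp)

/-- Value of a natural-number expression. -/
def IExp.eval (s : State) : IExp → ℕ
  | .const m => m
  | .var x => s.ivar x
  | .get a e => s.iarr a (e.eval s)
  | .add e f => e.eval s + f.eval s
  | .sub e f => e.eval s - f.eval s

/-- Value of a real expression. -/
noncomputable def RExp.eval (s : State) : RExp → ℝ
  | .const q => (q : ℝ)
  | .var x => s.rvar x
  | .get a e => s.rarr a (e.eval s)
  | .ofNat e => (e.eval s : ℝ)
  | .add e f => e.eval s + f.eval s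
  | .sub e f => e.eval s - f.eval s
  | .mul e f => e.eval s * f.eval s
  | .div e f => e.eval s / f.eval s
  | .sqrt e => Real.sqrt (e.eval s)

/-- Truth of a test. -/
def BExp.eval (s : State) : BExp → Prop
  | .ilt e f => e.eval s < f.eval s
  | .rlt e f => e.eval s < f.eval s
  | .not b => ¬ b.eval s
  | .and b c => b.eval s ∧ c.eval s

/-- Evaluation time of an expression: the number of its operations, variables and constants. -/
def IExp.cost : IExp → ℕ
  | .const _ => 1
  | .var _ => 1
  | .get _ e => e.cost + 1
  | .add e f => e.cost + f.cost + 1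
  | .sub e f => e.cost + f.cost + 1

/-- Evaluation time of a real expression. -/
def RExp.cost : RExp → ℕ
  | .const _ => 1
  | .var _ => 1
  | .get _ e => e.cost + 1
  | .ofNat e => e.cost + 1
  | .add e f => e.cost + f.cost + 1
  | .sub e f => e.cost + f.cost + 1
  | .mul e f => e.cost + f.cost + 1
  | .div e f => e.cost + f.cost + 1
  | .sqrt e => e.cost + 1

/-- Evaluation time of a test. -/
def BExp.cost : BExp → ℕ
  | .ilt e f => e.cost + f.cost + 1
  | .rlt e f => e.cost + f.cost + 1
  | .not b => b.cost + 1
  | .and b c => b.cost + c.cost + 1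

/-- Commands (programs). -/
inductive Cmd where
  | skip
  /-- assign a natural-number variable -/
  | iset (x : ℕ) (e : IExp)
  /-- assign a real variable -/
  | rset (x : ℕ) (e : RExp)
  /-- write entry `i` of the natural-number array `a` -/
  | iput (a : ℕ) (i : IExp) (e : IExp)
  /-- write entry `i` of the real array `a` -/
  | rput (a : ℕ) (i : IExp) (e : RExp)
  /-- `x :=` a fair coin flip, `0` or `1` -/
  | coin (x : ℕ)
  /-- `x :=` a uniformly random vertex -/
  | randVertex (x : ℕ)
  /-- `x :=` a uniformly random neighbor of vertex `v` -/
  | randNbr (x : ℕ) (v : IExp)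
  /-- `x :=` the degree of vertex `v` -/
  | degree (x : ℕ) (v : IExp)
  /-- write the neighbors of vertex `v` to entries `0, …, deg v - 1` of array `a` -/
  | readNbrs (a : ℕ) (v : IExp)
  | seq (c d : Cmd)
  | ite (b : BExp) (c d : Cmd)
  | while (b : BExp) (c : Cmd)

/-- The uniform distribution on a finite set of naturals (the point mass at `0` if it is empty). -/
noncomputable def unif (S : Finset ℕ) : PMF ℕ :=
  if h : S.Nonempty then PMF.uniformOfFinset S h else PMF.pure 0

/-- Assign a natural-number variable. -/
def State.setI (s : State) (x v : ℕ) : State :=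
  { s with ivar := Function.update s.ivar x v }

/-- Assign a real variable. -/
noncomputable def State.setR (s : State) (x : ℕ) (v : ℝ) : State :=
  { s with rvar := Function.update s.rvar x v }

/-- Write one entry of a natural-number array. -/
def State.putI (s : State) (a i v : ℕ) : State :=
  { s with iarr := Function.update s.iarr a (Function.update (s.iarr a) i v) }

/-- Write one entry of a real array. -/
noncomputable def State.putR (s : State) (a i : ℕ) (v : ℝ) : State :=
  { s with rarr := Function.update s.rarr a (Function.update (s.rarr a) i v) }

/-- Write a list to the initial entries of a natural-number array. -/
def State.putList (s : State) (a : ℕ) (l : List ℕ) : State :=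
  { s with iarr := Function.update s.iarr a (fun i => l.getD i (s.iarr a i)) }

/-- A configuration: the commands still to be executed, the memory, and the time spent so far. The
machine has halted when no command is left. -/
structure Config where
  todo : List Cmd
  state : State
  time : ℕ

open Classical in
/-- One step of the machine on an `n`-vertex graph in which vertex `v` has the neighbors `adj v`.
Every command takes constant time in addition to the evaluation of its expressions, except
`readNbrs`, which takes additional time equal to the degree of the vertex. -/
noncomputable def step (n : ℕ) (adj : ℕ → List ℕ) : Config → PMF Config
  | ⟨[], s, t⟩ => PMF.pure ⟨[], s, t⟩
  | ⟨.skip :: K, s, t⟩ => PMF.pure ⟨K, s, t + 1⟩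
  | ⟨.iset x e :: K, s, t⟩ => PMF.pure ⟨K, s.setI x (e.eval s), t + e.cost + 1⟩
  | ⟨.rset x e :: K, s, t⟩ => PMF.pure ⟨K, s.setR x (e.eval s), t + e.cost + 1⟩
  | ⟨.iput a i e :: K, s, t⟩ =>
      PMF.pure ⟨K, s.putI a (i.eval s) (e.eval s), t + i.cost + e.cost + 1⟩
  | ⟨.rput a i e :: K, s, t⟩ =>
      PMF.pure ⟨K, s.putR a (i.eval s) (e.eval s), t + i.cost + e.cost + 1⟩
  | ⟨.coin x :: K, s, t⟩ => (unif {0, 1}).map fun v => ⟨K, s.setI x v, t + 1⟩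
  | ⟨.randVertex x :: K, s, t⟩ => (unif (Finset.range n)).map fun v => ⟨K, s.setI x v, t + 1⟩
  | ⟨.randNbr x v :: K, s, t⟩ =>
      (unif (adj (v.eval s)).toFinset).map fun w => ⟨K, s.setI x w, t + v.cost + 1⟩
  | ⟨.degree x v :: K, s, t⟩ =>
      PMF.pure ⟨K, s.setI x (adj (v.eval s)).length, t + v.cost + 1⟩
  | ⟨.readNbrs a v :: K, s, t⟩ =>
      PMF.pure ⟨K, s.putList a (adj (v.eval s)), t + v.cost + (adj (v.eval s)).length + 1⟩
  | ⟨.seq c d :: K, s, t⟩ => PMF.pure ⟨c :: d :: K, s, t + 1⟩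
  | ⟨.ite b c d :: K, s, t⟩ =>
      PMF.pure ⟨(if b.eval s then c else d) :: K, s, t + b.cost + 1⟩
  | ⟨.while b c :: K, s, t⟩ =>
      PMF.pure ⟨if b.eval s then c :: .while b c :: K else K, s, t + b.cost + 1⟩

/-- The distribution of the configuration after `T` steps. -/
noncomputable def run (n : ℕ) (adj : ℕ → List ℕ) (c₀ : Config) : ℕ → PMF Config
  | 0 => PMF.pure c₀
  | T + 1 => (run n adj c₀ T).bind (step n adj)

/-- The input: `n` in natural-number variable `0`, `ε` and `δ` in real variables `0` and `1`;
all other memory is zero. -/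
noncomputable def initState (n : ℕ) (ε δ : ℝ) : State where
  ivar := Function.update (fun _ => 0) 0 n
  rvar := Function.update (Function.update (fun _ => 0) 0 ε) 1 δ
  iarr := fun _ _ => 0
  rarr := fun _ _ => 0

/-- The output: the function described by the first `m` entries of real array `0`, where `m` is the
content of natural-number variable `0`. -/
noncomputable def State.output (s : State) : ℝ → ℝ :=
  chebyshevDensity (s.ivar 0) (s.rarr 0)

variable {n : ℕ} {G : SimpleGraph (Fin n)}

/-- The run of program `P` on the graph given by `L`, with parameters `ε` and `δ`. -/
noncomputable def exec (P : Cmd) (L : AdjList G) (ε δ : ℝ) : ℕ → PMF Config :=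
  run n L.lookup ⟨[P], initState n ε δ, 0⟩

/-- The expected running time: the (monotone) limit over `T` of the expected time spent in the
first `T` steps. It is infinite if the program fails to halt with positive probability. -/
noncomputable def expectedTime (P : Cmd) (L : AdjList G) (ε δ : ℝ) : ℝ≥0∞ :=
  ⨆ T : ℕ, ∑' c : Config, exec P L ε δ T c * (c.time : ℝ≥0∞)

/-- The probability that the program halts with an output function that satisfies `Q`: the
(monotone) limit over `T` of the probability that this has happened within `T` steps. -/
noncomputable def outputProb (P : Cmd) (L : AdjList G) (ε δ : ℝ) (Q : (ℝ → ℝ) → Prop) : ℝ≥0∞ :=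
  ⨆ T : ℕ, (exec P L ε δ T).toOuterMeasure {c | c.todo = [] ∧ Q c.state.output}

end RAM

end SDE

/-! The algorithm computes exact local data at a few random vertices. Let `B` be the normalized
adjacency matrix with all entries at vertices of degree above `32/ε²` set to zero, the remaining
entries keeping their original degrees. An edge entry has square `1/(d_a d_b)`, so a discarded edge
can be charged to the endpoint opposite a high-degree one. The squared Frobenius error is then at
most `n ε²/16`, and a Hoffman–Wielandt argument (`sum_eigenvalues_sub_le`) bounds the resulting move
of the spectral density by `ε/4` in Wasserstein distance. In exchange, a product of `B` with a
vector costs only `O(n/ε²)`.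

For a vertex `v` the numbers `T_k(B)_{vv}` are the Chebyshev moments of its local spectral measure,
a probability measure on `[-1, 1]`. The three-term recurrence computes them exactly from the column
`e_v`. Their mean over all `v` is the `k`-th Chebyshev moment of the spectrum of `B`. They are
bounded by `1`, so an exponential moment bound and a union bound (`draws_uniform_tail`) show that
`l` uniform samples give all `N` moments within `η = ε/(4N)`, except with probability at most `2N
exp(-l η²/16)`.

The coefficients are damped by the Fejér factors `1 - k/N`. The sampled moments belong to a genuine
probability measure and the Fejér kernel is nonnegative with mean one, so every sample yields a
probability density; only accuracy depends on chance. The kernel has second moment `1/N` about its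
centre, so with `N = ⌈16/ε²⌉` the smoothing costs at most `ε/4`, and the sampling error at most `2Nη
= ε/2` (`W1_sampleCoeff_le`).

The machine can neither round nor take logarithms. It finds `N` by counting, and stops sampling as
soon as `δ (1 + η²/16)^l ≥ 2N`; since `1 + y ≤ exp y`, this suffices for the tail bound. The only
random choices are the sampled vertices, and their number is fixed in advance by the parameters. A
run is therefore a synchronized sampling loop (`run_random_while`) followed by a deterministic
program verified with loop invariants (`ends_evalCmd`). -/

namespace SDE

/-! ## Chebyshev series and the Fejér kernel -/

section Fejer

open Polynomial.Chebyshev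

/-- The value of the Chebyshev polynomial `T_k` at `x`. -/
noncomputable def chebT (k : ℕ) (x : ℝ) : ℝ := (T ℝ (k : ℤ)).eval x

@[fun_prop]
theorem continuous_chebT (k : ℕ) : Continuous (chebT k) := by
  unfold chebT; fun_prop

theorem chebT_cos (k : ℕ) (θ : ℝ) : chebT k (Real.cos θ) = Real.cos (k * θ) := by
  simp [chebT, T_real_cos]

@[simp] theorem chebT_zero (x : ℝ) : chebT 0 x = 1 := by simp [chebT]

@[simp] theorem chebT_one (x : ℝ) : chebT 1 x = x := by simp [chebT]

theorem chebT_two (x : ℝ) : chebT 2 x = 2 * x ^ 2 - 1 := by simp [chebT, T_two]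

theorem chebT_add_two (k : ℕ) (x : ℝ) :
    chebT (k + 2) x = 2 * x * chebT (k + 1) x - chebT k x := by
  simp [chebT, T_add_two]

theorem exists_cos_eq {x : ℝ} (hx : |x| ≤ 1) : ∃ θ, Real.cos θ = x :=
  ⟨Real.arccos x, Real.cos_arccos (abs_le.1 hx).1 (abs_le.1 hx).2⟩

theorem abs_chebT_le_one (k : ℕ) {x : ℝ} (hx : |x| ≤ 1) : |chebT k x| ≤ 1 := by
  obtain ⟨θ, rfl⟩ := exists_cos_eq hx
  rw [chebT_cos]; exact Real.abs_cos_le_one _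

/-- The coefficients `1, 2, 2, …` of the Chebyshev expansion of the delta distribution. -/
def chebWeight (k : ℕ) : ℝ := if k = 0 then 1 else 2

/-- Group the pairs by `|i - j| = k`: there are `N` of them for `k = 0` and `2(N - k)` otherwise.
The induction adds one row and one column, which have equal sums because cosine is even. -/
theorem sum_cos_sub (N : ℕ) (φ : ℝ) :
    ∑ i ∈ Finset.range N, ∑ j ∈ Finset.range N, Real.cos ((i - j) * φ) =
      ∑ k ∈ Finset.range N, chebWeight k * (N - k) * Real.cos (k * φ) := by
  have tail : ∀ N : ℕ, ∑ i ∈ Finset.range N, Real.cos (((i : ℝ) - N) * φ) =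
      ∑ k ∈ Finset.range N, Real.cos ((k + 1 : ℝ) * φ) := by
    intro N
    rw [← Finset.sum_range_reflect]
    refine Finset.sum_congr rfl fun i hi => ?_
    have h : i + 1 ≤ N := Finset.mem_range.1 hi
    rw [← Real.cos_neg]
    congr 1
    rw [show N - 1 - i = N - (i + 1) by omega, Nat.cast_sub h]
    push_cast; ring
  have weights : ∀ N : ℕ, ∑ k ∈ Finset.range (N + 1), chebWeight k * Real.cos (k * φ) =
      1 + 2 * ∑ k ∈ Finset.range N, Real.cos ((k + 1 : ℝ) * φ) := by
    intro N
    rw [Finset.sum_range_succ', Finset.mul_sum]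
    simp [chebWeight, add_comm]
  induction N with
  | zero => simp
  | succ N ih =>
    rw [Finset.sum_range_succ]
    simp_rw [Finset.sum_range_succ (fun j : ℕ => Real.cos ((_ - (j : ℝ)) * φ))]
    rw [Finset.sum_add_distrib, ih, tail]
    have symm : ∑ j ∈ Finset.range N, Real.cos (((N : ℝ) - j) * φ) =
        ∑ i ∈ Finset.range N, Real.cos (((i : ℝ) - N) * φ) := by
      refine Finset.sum_congr rfl fun i _ => ?_
      rw [← Real.cos_neg]; congr 1; ring
    rw [symm, tail]
    have split : ∑ k ∈ Finset.range (N + 1), chebWeight k * (((N + 1 : ℕ) : ℝ) - k) *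
        Real.cos (k * φ) = ∑ k ∈ Finset.range (N + 1), chebWeight k * (N - k) * Real.cos (k * φ)
          + ∑ k ∈ Finset.range (N + 1), chebWeight k * Real.cos (k * φ) := by
      rw [← Finset.sum_add_distrib]
      refine Finset.sum_congr rfl fun k _ => ?_
      push_cast; ring
    rw [split, weights, Finset.sum_range_succ (fun k : ℕ => chebWeight k * (N - k) * _)]
    simp
    ring

/-- The sum is the squared modulus of `∑ exp(i j φ)` over `j < N`. -/
theorem fejer_nonneg (N : ℕ) (φ : ℝ) :
    0 ≤ ∑ k ∈ Finset.range N, chebWeight k * (N - k) * Real.cos (k * φ) := by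
  rw [← sum_cos_sub]
  have : ∑ i ∈ Finset.range N, ∑ j ∈ Finset.range N, Real.cos (((i : ℝ) - j) * φ) =
      (∑ i ∈ Finset.range N, Real.cos (i * φ)) ^ 2 +
        (∑ i ∈ Finset.range N, Real.sin (i * φ)) ^ 2 := by
    simp_rw [sq, Finset.sum_mul_sum, ← Finset.sum_add_distrib, sub_mul, Real.cos_sub]
  rw [this]; positivity

/-- The coefficient of `T_k x * T_k y` in the Fejér kernel. -/
noncomputable def fejerCoeff (N k : ℕ) : ℝ := chebWeight k * (1 - k / N)

/-- The Fejér kernel of order `N` for Chebyshev series. -/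
noncomputable def fejerKernel (N : ℕ) (x y : ℝ) : ℝ :=
  ∑ k ∈ Finset.range N, fejerCoeff N k * chebT k x * chebT k y

/-- With `x = cos α` and `y = cos β`, product-to-sum turns the kernel into a mean of classical Fejér
kernels at `α + β` and `α - β`. -/
theorem fejerKernel_nonneg (N : ℕ) {x y : ℝ} (hx : |x| ≤ 1) (hy : |y| ≤ 1) :
    0 ≤ fejerKernel N x y := by
  rcases N.eq_zero_or_pos with rfl | hN
  · simp [fejerKernel]
  obtain ⟨α, rfl⟩ := exists_cos_eq hx
  obtain ⟨β, rfl⟩ := exists_cos_eq hy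
  have hN' : (N : ℝ) ≠ 0 := by positivity
  have : fejerKernel N (Real.cos α) (Real.cos β) = (2 * N : ℝ)⁻¹ *
      (∑ k ∈ Finset.range N, chebWeight k * (N - k) * Real.cos (k * (α + β)) +
        ∑ k ∈ Finset.range N, chebWeight k * (N - k) * Real.cos (k * (α - β))) := by
    rw [← Finset.sum_add_distrib, Finset.mul_sum]
    refine Finset.sum_congr rfl fun k _ => ?_
    rw [chebT_cos, chebT_cos, mul_add (k : ℝ), mul_sub (k : ℝ), Real.cos_add, Real.cos_sub,
      fejerCoeff]
    field_simp
    ring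
  rw [this]
  have h1 := fejer_nonneg N (α + β)
  have h2 := fejer_nonneg N (α - β)
  positivity

@[fun_prop]
theorem continuous_fejerKernel (N : ℕ) (x : ℝ) : Continuous (fejerKernel N x) := by
  unfold fejerKernel; fun_prop

theorem fejerCoeff_nonneg (N : ℕ) {k : ℕ} (hk : k < N) : 0 ≤ fejerCoeff N k := by
  have : (k : ℝ) / N ≤ 1 := div_le_one_of_le₀ (by exact_mod_cast hk.le) (by positivity)
  unfold fejerCoeff chebWeight
  split_ifs <;> nlinarith

theorem fejerCoeff_le_two (N : ℕ) {k : ℕ} : fejerCoeff N k ≤ 2 := by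
  have : 0 ≤ (k : ℝ) / N := by positivity
  unfold fejerCoeff chebWeight
  split_ifs <;> nlinarith

/-! ### Integration against the arcsine law -/

/-- The expectation with respect to the arcsine distribution on `[-1, 1]`. -/
noncomputable def arcMean (f : ℝ → ℝ) : ℝ := Real.pi⁻¹ * ∫ x, f x ∂measureT

theorem arcMean_add {f g : ℝ → ℝ} (hf : Continuous f) (hg : Continuous g) :
    arcMean (fun x => f x + g x) = arcMean f + arcMean g := by
  rw [arcMean, integral_add (integrable_measureT hf.continuousOn)
    (integrable_measureT hg.continuousOn), mul_add]; rfl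

theorem arcMean_sub {f g : ℝ → ℝ} (hf : Continuous f) (hg : Continuous g) :
    arcMean (fun x => f x - g x) = arcMean f - arcMean g := by
  rw [arcMean, integral_sub (integrable_measureT hf.continuousOn)
    (integrable_measureT hg.continuousOn), mul_sub]; rfl

theorem arcMean_const_mul (c : ℝ) (f : ℝ → ℝ) :
    arcMean (fun x => c * f x) = c * arcMean f := by
  rw [arcMean, integral_const_mul, arcMean]; ring

theorem arcMean_sum {ι : Type*} (s : Finset ι) {f : ι → ℝ → ℝ}
    (hf : ∀ i ∈ s, Continuous (f i)) :
    arcMean (fun x => ∑ i ∈ s, f i x) = ∑ i ∈ s, arcMean (f i) := by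
  rw [arcMean, integral_finsetSum s fun i hi => integrable_measureT (hf i hi).continuousOn,
    Finset.mul_sum]; rfl

theorem arcMean_mono {f g : ℝ → ℝ} (hf : Continuous f) (hg : Continuous g)
    (h : ∀ x, |x| ≤ 1 → f x ≤ g x) : arcMean f ≤ arcMean g := by
  have hmono : ∫ x, f x ∂measureT ≤ ∫ x, g x ∂measureT := by
    refine integral_mono_ae (integrable_measureT hf.continuousOn)
      (integrable_measureT hg.continuousOn) ?_
    refine (ae_restrict_iff' measurableSet_Ioc).2 (Filter.Eventually.of_forall fun x hx => ?_)
    exact h x (abs_le.2 ⟨hx.1.le, hx.2⟩)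
  exact mul_le_mul_of_nonneg_left hmono (by positivity)

theorem arcMean_chebT_mul (k l : ℕ) :
    arcMean (fun x => chebT k x * chebT l x) = if k = l then (chebWeight k)⁻¹ else 0 := by
  have hpi := Real.pi_ne_zero
  unfold arcMean chebT
  split_ifs with h
  · subst h
    rcases eq_or_ne k 0 with rfl | hk
    · rw [Nat.cast_zero, integral_eval_T_real_mul_self_measureT_zero]
      simp [chebWeight, hpi]
    · rw [integral_T_real_mul_self_measureT_of_ne_zero hk]
      simp only [chebWeight, hk, if_false]
      field_simp
  · rw [integral_eval_T_real_mul_eval_T_real_measureT_of_ne h, mul_zero]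

theorem arcMean_one : arcMean (fun _ => 1) = 1 := by
  have := arcMean_chebT_mul 0 0
  simpa [chebWeight] using this

/-- By orthogonality, Fejér smoothing acts diagonally on the Chebyshev basis, with multipliers `1 -
l/N`. Mass and second moment of the kernel follow from `l = 0, 1, 2`. -/
theorem arcMean_chebT_mul_fejerKernel {N l : ℕ} (hl : l < N) (x : ℝ) :
    arcMean (fun y => chebT l y * fejerKernel N x y) = (1 - l / N) * chebT l x := by
  have : (fun y => chebT l y * fejerKernel N x y) = fun y =>
      ∑ k ∈ Finset.range N, (fejerCoeff N k * chebT k x) * (chebT l y * chebT k y) := by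
    funext y
    rw [fejerKernel, Finset.mul_sum]
    exact Finset.sum_congr rfl fun k _ => by ring
  rw [this, arcMean_sum _ fun k _ => by fun_prop]
  simp_rw [arcMean_const_mul, arcMean_chebT_mul]
  rw [Finset.sum_eq_single l]
  · rw [if_pos rfl, fejerCoeff]
    have : chebWeight l ≠ 0 := by unfold chebWeight; split_ifs <;> norm_num
    field_simp
  · intro k _ hk; rw [if_neg hk.symm, mul_zero]
  · intro h; exact absurd (Finset.mem_range.2 hl) h

theorem arcMean_fejerKernel {N : ℕ} (hN : 0 < N) (x : ℝ) :
    arcMean (fejerKernel N x) = 1 := by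
  simpa using arcMean_chebT_mul_fejerKernel hN x

theorem arcMean_sq_sub_mul_fejerKernel {N : ℕ} (hN : 2 < N) (x : ℝ) :
    arcMean (fun y => (y - x) ^ 2 * fejerKernel N x y) = 1 / N := by
  have hN' : (N : ℝ) ≠ 0 := by positivity
  have : (fun y => (y - x) ^ 2 * fejerKernel N x y) = fun y =>
      (2⁻¹ * (chebT 2 y * fejerKernel N x y) + (-2 * x) * (chebT 1 y * fejerKernel N x y)) +
        (2⁻¹ + x ^ 2) * (chebT 0 y * fejerKernel N x y) := by
    funext y
    rw [chebT_two, chebT_one, chebT_zero]; ring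
  rw [this, arcMean_add (by fun_prop) (by fun_prop), arcMean_add (by fun_prop) (by fun_prop)]
  simp only [arcMean_const_mul]
  rw [arcMean_chebT_mul_fejerKernel hN, arcMean_chebT_mul_fejerKernel (by omega),
    arcMean_chebT_mul_fejerKernel (by omega), chebT_two, chebT_one, chebT_zero]
  push_cast
  field_simp
  ring

/-- Smoothing with the Fejér kernel moves a 1-Lipschitz function by at most `1/√N`. -/
theorem arcMean_mul_fejerKernel_le {N : ℕ} (hN : 2 < N) {f : ℝ → ℝ} (hf : LipschitzWith 1 f)
    {x t : ℝ} (hx : |x| ≤ 1) (ht : 0 < t) (hNt : 1 ≤ N * t ^ 2) :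
    arcMean (fun y => f y * fejerKernel N x y) ≤ f x + t := by
  have hfc := hf.continuous
  have hN' : (0 : ℝ) < N := by positivity
  have key : arcMean (fun y => f y * fejerKernel N x y) ≤
      arcMean (fun y => (f x + t / 2) * fejerKernel N x y +
        (2 * t)⁻¹ * ((y - x) ^ 2 * fejerKernel N x y)) := by
    refine arcMean_mono (by fun_prop) (by fun_prop) fun y hy => ?_
    have hK := fejerKernel_nonneg N hx hy
    have h1 : f y - f x ≤ |y - x| := by
      have := hf.dist_le_mul y x
      simp only [NNReal.coe_one, one_mul, Real.dist_eq] at this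
      exact (le_abs_self _).trans this
    -- This inequality between arithmetic and geometric means replaces Cauchy–Schwarz: integrating
    -- the quadratic bound against the kernel needs only its second moment `1/N ≤ t²`.
    have h2 : |y - x| ≤ t / 2 + (2 * t)⁻¹ * (y - x) ^ 2 := by
      rw [← sq_abs (y - x), ← sub_nonneg]
      have : t / 2 + (2 * t)⁻¹ * |y - x| ^ 2 - |y - x| = (|y - x| - t) ^ 2 / (2 * t) := by
        field_simp; ring
      rw [this]; positivity
    calc f y * fejerKernel N x y ≤ (f x + t / 2 + (2 * t)⁻¹ * (y - x) ^ 2) * fejerKernel N x y :=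
          mul_le_mul_of_nonneg_right (by linarith) hK
      _ = _ := by ring
  rw [arcMean_add (by fun_prop) (by fun_prop), arcMean_const_mul, arcMean_const_mul,
    arcMean_fejerKernel (by omega), arcMean_sq_sub_mul_fejerKernel hN] at key
  have : (2 * t)⁻¹ * (1 / N) ≤ t / 2 := by
    rw [inv_mul_eq_div, div_div, div_le_div_iff₀ (by positivity) (by positivity)]
    nlinarith
  linarith

/-! ## Densities given by Chebyshev series -/

theorem chebyshevDensity_eq (m : ℕ) (c : ℕ → ℝ) (x : ℝ) :
    chebyshevDensity m c x = (∑ k ∈ Finset.range m, c k * chebT k (1 - x)) *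
      (Real.pi⁻¹ * (Real.sqrt (1 - (1 - x) ^ 2))⁻¹) := by
  rw [chebyshevDensity, div_eq_mul_inv, mul_inv]; rfl

theorem measurable_chebyshevDensity (m : ℕ) (c : ℕ → ℝ) :
    Measurable (chebyshevDensity m c) := by
  have : chebyshevDensity m c = fun x => (∑ k ∈ Finset.range m, c k * chebT k (1 - x)) *
      (Real.pi⁻¹ * (Real.sqrt (1 - (1 - x) ^ 2))⁻¹) := funext (chebyshevDensity_eq m c)
  rw [this]
  have : Continuous fun x : ℝ => ∑ k ∈ Finset.range m, c k * chebT k (1 - x) := by fun_prop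
  exact this.measurable.mul (by fun_prop)

/-- The substitution `y = 1 - x` turns the factor `1/(π √(1 - y²))` into the arcsine law. Only a
change of variables and constant factors are involved, so `f` may be arbitrary. -/
theorem setIntegral_mul_chebyshevDensity (m : ℕ) (c : ℕ → ℝ) (f : ℝ → ℝ) :
    ∫ x in Set.Icc (0 : ℝ) 2, f x * chebyshevDensity m c x =
      arcMean (fun y => f (1 - y) * ∑ k ∈ Finset.range m, c k * chebT k y) := by
  simp_rw [arcMean, integral_measureT, Real.sqrt_inv]
  rw [integral_Icc_eq_integral_Ioc,
    ← intervalIntegral.integral_of_le (by norm_num), ← intervalIntegral.integral_const_mul]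
  have := intervalIntegral.integral_comp_sub_left (a := (0 : ℝ)) (b := 2) (fun y => Real.pi⁻¹ *
    ((f (1 - y) * ∑ k ∈ Finset.range m, c k * chebT k y) * (Real.sqrt (1 - y ^ 2))⁻¹)) 1
  norm_num only at this
  rw [← this]
  refine intervalIntegral.integral_congr fun x _ => ?_
  simp only [chebyshevDensity_eq, sub_sub_cancel]
  ring

theorem chebyshevDensity_nonneg {m : ℕ} {c : ℕ → ℝ}
    (hc : ∀ y, |y| ≤ 1 → 0 ≤ ∑ k ∈ Finset.range m, c k * chebT k y) {x : ℝ}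
    (hx : x ∈ Set.Icc (0 : ℝ) 2) : 0 ≤ chebyshevDensity m c x := by
  rw [chebyshevDensity_eq]
  have := hc (1 - x) (abs_le.2 ⟨by linarith [hx.2], by linarith [hx.1]⟩)
  have := Real.pi_pos
  positivity

theorem isDensity_chebyshevDensity {m : ℕ} {c : ℕ → ℝ}
    (hc : ∀ y, |y| ≤ 1 → 0 ≤ ∑ k ∈ Finset.range m, c k * chebT k y)
    (h1 : arcMean (fun y => ∑ k ∈ Finset.range m, c k * chebT k y) = 1) :
    IsDensity (chebyshevDensity m c) := by
  refine ⟨measurable_chebyshevDensity m c, fun x hx => chebyshevDensity_nonneg hc hx, ?_⟩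
  have hint : ∫ x in Set.Icc (0 : ℝ) 2, chebyshevDensity m c x = 1 := by
    have := setIntegral_mul_chebyshevDensity m c (fun _ => 1)
    simpa [h1] using this
  rw [← ofReal_integral_eq_lintegral_ofReal, hint, ENNReal.ofReal_one]
  -- The integral of a nonintegrable function is `0` by convention, so the value `1` already proves
  -- integrability.
  · by_contra hni
    rw [integral_undef hni] at hint
    exact zero_ne_one hint
  · exact (ae_restrict_iff' measurableSet_Icc).2
      (Filter.Eventually.of_forall fun x hx => chebyshevDensity_nonneg hc hx)

theorem integral_densityMeasure {m : ℕ} {c : ℕ → ℝ}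
    (hc : ∀ y, |y| ≤ 1 → 0 ≤ ∑ k ∈ Finset.range m, c k * chebT k y) (f : ℝ → ℝ) :
    ∫ x, f x ∂(densityMeasure (chebyshevDensity m c)) =
      arcMean (fun y => f (1 - y) * ∑ k ∈ Finset.range m, c k * chebT k y) := by
  rw [← setIntegral_mul_chebyshevDensity, densityMeasure,
    integral_withDensity_eq_integral_toReal_smul
      (measurable_chebyshevDensity m c).ennreal_ofReal (by simp)]
  refine setIntegral_congr_fun measurableSet_Icc fun x hx => ?_
  simp only [smul_eq_mul]
  rw [ENNReal.toReal_ofReal (chebyshevDensity_nonneg hc hx), mul_comm]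

end Fejer

/-! ## Spectra of symmetric matrices -/

section SpectralResolution

variable {n : ℕ}

/-- The `a`-th coordinate of the `i`-th vector of an orthonormal eigenbasis. -/
noncomputable def eigenCoord {M : Matrix (Fin n) (Fin n) ℝ} (hM : M.IsHermitian)
    (i a : Fin n) : ℝ := hM.eigenvectorBasis i a

variable {M M' : Matrix (Fin n) (Fin n) ℝ} (hM : M.IsHermitian) (hM' : M'.IsHermitian)

theorem sum_eigenCoord_mul (i j : Fin n) :
    ∑ a, eigenCoord hM i a * eigenCoord hM j a = if i = j then 1 else 0 := by
  have := orthonormal_iff_ite.1 hM.eigenvectorBasis.orthonormal i j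
  rw [← this]
  simp [PiLp.inner_apply, eigenCoord, mul_comm]

theorem sum_eigenCoord_mul' (a b : Fin n) :
    ∑ i, eigenCoord hM i a * eigenCoord hM i b = if a = b then 1 else 0 := by
  -- The rows of this square matrix are orthonormal, hence so are its columns.
  have h : (Matrix.of (eigenCoord hM)) * (Matrix.of (eigenCoord hM)).transpose = 1 := by
    ext i j
    simp [Matrix.mul_apply, Matrix.one_apply, sum_eigenCoord_mul]
  have h' := congrArg (fun X : Matrix (Fin n) (Fin n) ℝ => X a b) (mul_eq_one_comm.1 h)
  simpa [Matrix.mul_apply, Matrix.one_apply] using h'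

theorem sum_mul_eigenCoord (i a : Fin n) :
    ∑ b, M a b * eigenCoord hM i b = hM.eigenvalues i * eigenCoord hM i a := by
  have := congrFun (hM.mulVec_eigenvectorBasis i) a
  simpa [Matrix.mulVec, dotProduct, eigenCoord] using this

theorem sum_sq_sum_eigenCoord_mul (z : Fin n → ℝ) :
    ∑ i, (∑ a, eigenCoord hM i a * z a) ^ 2 = ∑ a, z a ^ 2 := by
  calc ∑ i, (∑ a, eigenCoord hM i a * z a) ^ 2
      = ∑ i, ∑ a, ∑ b, z a * z b * (eigenCoord hM i a * eigenCoord hM i b) := by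
        refine Finset.sum_congr rfl fun i _ => ?_
        rw [sq, Finset.sum_mul_sum]
        exact Finset.sum_congr rfl fun a _ => Finset.sum_congr rfl fun b _ => by ring
    _ = ∑ a, ∑ b, z a * z b * ∑ i, eigenCoord hM i a * eigenCoord hM i b := by
        rw [Finset.sum_comm]
        refine Finset.sum_congr rfl fun a _ => ?_
        rw [Finset.sum_comm]
        simp_rw [Finset.mul_sum]
    _ = ∑ a, z a ^ 2 := by
        simp [sum_eigenCoord_mul', sq]

/-- The squared inner products of two eigenbases: a doubly stochastic matrix. -/
noncomputable def overlap (i j : Fin n) : ℝ :=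
  (∑ a, eigenCoord hM i a * eigenCoord hM' j a) ^ 2

theorem sum_overlap_left (j : Fin n) : ∑ i, overlap hM hM' i j = 1 := by
  unfold overlap
  rw [sum_sq_sum_eigenCoord_mul]
  simpa [sq] using sum_eigenCoord_mul hM' j j

theorem sum_overlap_right (i : Fin n) : ∑ j, overlap hM hM' i j = 1 := by
  unfold overlap
  simp_rw [mul_comm (eigenCoord hM i _)]
  rw [sum_sq_sum_eigenCoord_mul]
  simpa [sq] using sum_eigenCoord_mul hM i i

theorem sub_mul_sum_eigenCoord (i j : Fin n) :
    (hM.eigenvalues i - hM'.eigenvalues j) * ∑ a, eigenCoord hM i a * eigenCoord hM' j a =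
      ∑ a, eigenCoord hM i a * ∑ b, eigenCoord hM' j b * (M a b - M' a b) := by
  have h1 : ∑ a, eigenCoord hM i a * ∑ b, eigenCoord hM' j b * M a b =
      hM.eigenvalues i * ∑ a, eigenCoord hM i a * eigenCoord hM' j a := by
    simp_rw [Finset.mul_sum]
    rw [Finset.sum_comm]
    refine Finset.sum_congr rfl fun b _ => ?_
    rw [← mul_assoc, ← sum_mul_eigenCoord, Finset.sum_mul]
    refine Finset.sum_congr rfl fun a _ => ?_
    have : M a b = M b a := by simpa using (hM.apply a b).symm
    rw [this]; ring
  have h2 : ∑ a, eigenCoord hM i a * ∑ b, eigenCoord hM' j b * M' a b =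
      hM'.eigenvalues j * ∑ a, eigenCoord hM i a * eigenCoord hM' j a := by
    rw [Finset.mul_sum]
    refine Finset.sum_congr rfl fun a _ => ?_
    simp_rw [mul_comm (eigenCoord hM' j _)]
    rw [sum_mul_eigenCoord]; ring
  simp_rw [mul_sub, Finset.sum_sub_distrib, mul_sub, Finset.sum_sub_distrib]
  rw [h1, h2]; ring

/-- Since `M` is symmetric, `(λ_i - λ'_j) ⟨u_i, u'_j⟩` is the coefficient of `M - M'` at the pair of
eigenvectors `u_i`, `u'_j`. Parseval in each index gives the squared Frobenius norm. -/
theorem sum_sq_sub_mul_overlap :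
    ∑ i, ∑ j, (hM.eigenvalues i - hM'.eigenvalues j) ^ 2 * overlap hM hM' i j =
      ∑ a, ∑ b, (M a b - M' a b) ^ 2 := by
  simp_rw [overlap, ← mul_pow, sub_mul_sum_eigenCoord]
  rw [Finset.sum_comm]
  simp_rw [sum_sq_sum_eigenCoord_mul]
  rw [Finset.sum_comm]
  simp_rw [sum_sq_sum_eigenCoord_mul]

/-- An integrated form of the Hoffman–Wielandt inequality. -/
theorem sum_eigenvalues_sub_le {f : ℝ → ℝ} (hf : LipschitzWith 1 f) {t : ℝ} (ht : 0 < t)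
    (h : ∑ a, ∑ b, (M a b - M' a b) ^ 2 ≤ n * t ^ 2) :
    ∑ i, f (hM.eigenvalues i) - ∑ j, f (hM'.eigenvalues j) ≤ n * t := by
  have h1 : ∑ i, f (hM.eigenvalues i) =
      ∑ i, ∑ j, f (hM.eigenvalues i) * overlap hM hM' i j := by
    simp_rw [← Finset.mul_sum, sum_overlap_right, mul_one]
  have h2 : ∑ j, f (hM'.eigenvalues j) =
      ∑ i, ∑ j, f (hM'.eigenvalues j) * overlap hM hM' i j := by
    rw [Finset.sum_comm]
    simp_rw [← Finset.mul_sum, sum_overlap_left, mul_one]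
  rw [h1, h2, ← Finset.sum_sub_distrib]
  simp_rw [← Finset.sum_sub_distrib, ← sub_mul]
  -- The matrix `overlap / n` is a coupling of the two spectral measures whose quadratic cost is the
  -- squared Frobenius distance over `n`; the linear cost is dominated by the quadratic one as in
  -- the smoothing estimate.
  calc ∑ i, ∑ j, (f (hM.eigenvalues i) - f (hM'.eigenvalues j)) * overlap hM hM' i j
      ≤ ∑ i, ∑ j, (t / 2 * overlap hM hM' i j +
          (2 * t)⁻¹ * ((hM.eigenvalues i - hM'.eigenvalues j) ^ 2 * overlap hM hM' i j)) := by
        refine Finset.sum_le_sum fun i _ => Finset.sum_le_sum fun j _ => ?_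
        set x := hM.eigenvalues i
        set y := hM'.eigenvalues j
        have hP : 0 ≤ overlap hM hM' i j := sq_nonneg _
        have h1 : f x - f y ≤ |x - y| := by
          have := hf.dist_le_mul x y
          simp only [NNReal.coe_one, one_mul, Real.dist_eq] at this
          exact (le_abs_self _).trans this
        have h2 : |x - y| ≤ t / 2 + (2 * t)⁻¹ * (x - y) ^ 2 := by
          rw [← sq_abs (x - y), ← sub_nonneg]
          have : t / 2 + (2 * t)⁻¹ * |x - y| ^ 2 - |x - y| = (|x - y| - t) ^ 2 / (2 * t) := by
            field_simp; ring
          rw [this]; positivity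
        calc _ ≤ (t / 2 + (2 * t)⁻¹ * (x - y) ^ 2) * overlap hM hM' i j :=
              mul_le_mul_of_nonneg_right (h1.trans h2) hP
          _ = _ := by ring
    _ = n * (t / 2) + (2 * t)⁻¹ * ∑ a, ∑ b, (M a b - M' a b) ^ 2 := by
        rw [← sum_sq_sub_mul_overlap hM hM']
        simp_rw [Finset.sum_add_distrib, ← Finset.mul_sum, sum_overlap_right]
        simp; ring
    _ ≤ n * (t / 2) + (2 * t)⁻¹ * (n * t ^ 2) := by gcongr
    _ = n * t := by field_simp; ring

end SpectralResolution

/-! ## The normalized adjacency matrix with the high-degree vertices cut off -/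

section Cutoff

variable {n : ℕ} (G : SimpleGraph (Fin n)) (low : Fin n → Prop)

open Classical in
/-- The normalized adjacency matrix restricted to the pairs of vertices satisfying `low`. -/
noncomputable def cutoffAdjacency : Matrix (Fin n) (Fin n) ℝ :=
  Matrix.of fun a b => if G.Adj a b ∧ low a ∧ low b then
    1 / Real.sqrt ((G.degree a : ℝ) * G.degree b) else 0

theorem cutoffAdjacency_comm (a b : Fin n) :
    cutoffAdjacency G low a b = cutoffAdjacency G low b a := by
  classical
  simp only [cutoffAdjacency, Matrix.of_apply, G.adj_comm a b, and_comm (a := low a),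
    mul_comm (G.degree a : ℝ)]

/-- The Laplacian of the truncated matrix. -/
noncomputable def cutoffLaplacian : Matrix (Fin n) (Fin n) ℝ := 1 - cutoffAdjacency G low

theorem cutoffLaplacian_isHermitian : (cutoffLaplacian G low).IsHermitian := by
  refine Matrix.isHermitian_one.sub ?_
  ext a b
  simpa using cutoffAdjacency_comm G low b a

open Classical in
theorem normalizedAdjacency_apply (a b : Fin n) : normalizedAdjacency G a b =
    if G.Adj a b then 1 / Real.sqrt ((G.degree a : ℝ) * G.degree b) else 0 := by
  unfold normalizedAdjacency
  rw [Matrix.mul_diagonal, Matrix.diagonal_mul, SimpleGraph.adjMatrix_apply]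
  split_ifs
  · rw [Real.sqrt_mul (by positivity), one_div, mul_inv, mul_one]
  · simp

open Classical in
theorem sum_adj_eq_degree (a : Fin n) (c : ℝ) :
    ∑ b, (if G.Adj a b then c else 0) = G.degree a * c := by
  rw [← Finset.sum_filter, Finset.sum_const, nsmul_eq_mul,
    ← SimpleGraph.card_neighborFinset_eq_degree, SimpleGraph.neighborFinset_eq_filter]

/-- Cutting off the vertices of degree above `1/κ` changes little in Frobenius norm. -/
theorem sum_sq_normalizedLaplacian_sub_cutoffLaplacian_le {κ : ℝ} (hκ : 0 ≤ κ)
    (hG : ∀ v, ∃ w, G.Adj v w)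
    (hlow : ∀ (v : Fin n) [Fintype (G.neighborSet v)], ¬ low v → 1 ≤ G.degree v * κ) :
    ∑ a, ∑ b, (normalizedLaplacian G a b - cutoffLaplacian G low a b) ^ 2 ≤ n * (2 * κ) := by
  classical
  have hdeg : ∀ v, (0 : ℝ) < G.degree v := fun v => by
    exact_mod_cast (G.degree_pos_iff_exists_adj v).2 (hG v)
  have hrow : ∀ a, ∑ b, (if G.Adj a b then (G.degree a : ℝ)⁻¹ * κ else 0) = κ := fun a => by
    rw [sum_adj_eq_degree, mul_inv_cancel_left₀ (hdeg a).ne']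
  calc ∑ a, ∑ b, (normalizedLaplacian G a b - cutoffLaplacian G low a b) ^ 2
      ≤ ∑ a, ∑ b, ((if G.Adj a b then (G.degree a : ℝ)⁻¹ * κ else 0) +
          (if G.Adj b a then (G.degree b : ℝ)⁻¹ * κ else 0)) := by
        refine Finset.sum_le_sum fun a _ => Finset.sum_le_sum fun b _ => ?_
        have ha := hdeg a
        have hb := hdeg b
        rw [normalizedLaplacian, cutoffLaplacian, Matrix.sub_apply, Matrix.sub_apply,
          sub_sub_sub_cancel_left, normalizedAdjacency_apply, cutoffAdjacency, Matrix.of_apply,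
          G.adj_comm b a]
        by_cases hab : G.Adj a b
        · simp only [hab, true_and, if_true]
          by_cases hl : low a ∧ low b
          · simp only [hl, and_self, if_true, sub_self]
            rw [zero_pow two_ne_zero]
            positivity
          -- A discarded entry has square `1/(d_a d_b)`. If `a` has high degree, this is at most
          -- `κ/d_b` and is charged to `b`, and vice versa. Each vertex has as many edges as its
          -- degree, so each of the two sums of charges contributes `κ` per vertex.
          · rw [if_neg hl, zero_sub, neg_sq, div_pow, one_pow, Real.sq_sqrt (by positivity)]
            rcases not_and_or.1 hl with h | h
            · have := hlow a h
              calc 1 / ((G.degree a : ℝ) * G.degree b)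
                  ≤ (G.degree a * κ) / ((G.degree a : ℝ) * G.degree b) := by gcongr
                _ = (G.degree b : ℝ)⁻¹ * κ := by field_simp
                _ ≤ _ := le_add_of_nonneg_left (by positivity)
            · have := hlow b h
              calc 1 / ((G.degree a : ℝ) * G.degree b)
                  ≤ (G.degree b * κ) / ((G.degree a : ℝ) * G.degree b) := by gcongr
                _ = (G.degree a : ℝ)⁻¹ * κ := by field_simp
                _ ≤ _ := le_add_of_nonneg_right (by positivity)
        · simp [hab]
    _ = n * (2 * κ) := by
        simp_rw [Finset.sum_add_distrib]
        rw [Finset.sum_comm (f := fun a b => if G.Adj b a then (G.degree b : ℝ)⁻¹ * κ else 0)]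
        simp_rw [hrow]
        simp; ring

/-- The `i`-th eigenvalue of the truncated matrix, as `1` minus one of the Laplacian. -/
noncomputable def cutoffEigenvalue (i : Fin n) : ℝ :=
  1 - (cutoffLaplacian_isHermitian G low).eigenvalues i

/-- The `a`-th coordinate of the `i`-th eigenvector of the truncated matrix. -/
noncomputable def cutoffCoord (i a : Fin n) : ℝ :=
  eigenCoord (cutoffLaplacian_isHermitian G low) i a

theorem sum_cutoffAdjacency_mul (i a : Fin n) :
    ∑ b, cutoffAdjacency G low a b * cutoffCoord G low i b =
      cutoffEigenvalue G low i * cutoffCoord G low i a := by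
  have h := sum_mul_eigenCoord (cutoffLaplacian_isHermitian G low) i a
  have h1 : ∑ b, cutoffLaplacian G low a b * cutoffCoord G low i b =
      cutoffCoord G low i a - ∑ b, cutoffAdjacency G low a b * cutoffCoord G low i b := by
    simp [cutoffLaplacian, sub_mul, Finset.sum_sub_distrib, Matrix.one_apply]
  have h2 : cutoffCoord G low i a - ∑ b, cutoffAdjacency G low a b * cutoffCoord G low i b =
    (cutoffLaplacian_isHermitian G low).eigenvalues i * cutoffCoord G low i a := h1.symm.trans h
  rw [cutoffEigenvalue]
  linarith

/-- In the quadratic form of a unit eigenvector, `|v_a v_b|/√(d_a d_b) ≤ v_a²/(2 d_a) + v_b²/(2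
d_b)`. Each vertex lies on at most `d_a` surviving edges, so the sum is at most `∑ v_a² = 1`. -/
theorem abs_cutoffEigenvalue_le_one (i : Fin n) : |cutoffEigenvalue G low i| ≤ 1 := by
  classical
  set v := cutoffCoord G low i
  set x := cutoffEigenvalue G low i
  have hv : ∑ a, v a * v a = 1 := by
    simpa [v, cutoffCoord] using sum_eigenCoord_mul (cutoffLaplacian_isHermitian G low) i i
  have hx : x = ∑ a, ∑ b, v a * (cutoffAdjacency G low a b * v b) := by
    simp_rw [← Finset.mul_sum]
    have : ∀ a, ∑ b, cutoffAdjacency G low a b * v b = x * v a :=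
      sum_cutoffAdjacency_mul G low i
    simp_rw [this]
    calc x = x * ∑ a, v a * v a := by rw [hv, mul_one]
      _ = _ := by rw [Finset.mul_sum]; exact Finset.sum_congr rfl fun a _ => by ring
  have hrow : ∀ a, ∑ b, (if G.Adj a b then v a ^ 2 / (2 * G.degree a) else 0) ≤
      v a * v a / 2 := fun a => by
    rw [sum_adj_eq_degree]
    rcases eq_or_ne (G.degree a : ℝ) 0 with h | h
    · rw [h, zero_mul]; nlinarith [mul_self_nonneg (v a)]
    · apply le_of_eq; field_simp
  calc |x| ≤ ∑ a, ∑ b, |v a * (cutoffAdjacency G low a b * v b)| := by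
        rw [hx]
        refine (Finset.abs_sum_le_sum_abs _ _).trans (Finset.sum_le_sum fun a _ => ?_)
        exact Finset.abs_sum_le_sum_abs _ _
    _ ≤ ∑ a, ∑ b, ((if G.Adj a b then v a ^ 2 / (2 * G.degree a) else 0) +
          (if G.Adj b a then v b ^ 2 / (2 * G.degree b) else 0)) := by
        refine Finset.sum_le_sum fun a _ => Finset.sum_le_sum fun b _ => ?_
        rw [cutoffAdjacency, Matrix.of_apply, G.adj_comm b a]
        by_cases hab : G.Adj a b
        · simp only [hab, true_and, if_true]
          have ha : (0 : ℝ) < G.degree a := by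
            exact_mod_cast (G.degree_pos_iff_exists_adj a).2 ⟨b, hab⟩
          have hb : (0 : ℝ) < G.degree b := by
            exact_mod_cast (G.degree_pos_iff_exists_adj b).2 ⟨a, hab.symm⟩
          split_ifs
          · rw [Real.sqrt_mul ha.le, abs_mul, abs_mul, abs_of_nonneg (by positivity :
              (0 : ℝ) ≤ 1 / (Real.sqrt (G.degree a) * Real.sqrt (G.degree b)))]
            have h1 : v a ^ 2 / (2 * (G.degree a : ℝ)) =
                (|v a| / Real.sqrt (G.degree a)) ^ 2 / 2 := by
              rw [div_pow, Real.sq_sqrt ha.le, sq_abs]; field_simp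
            have h2 : v b ^ 2 / (2 * (G.degree b : ℝ)) =
                (|v b| / Real.sqrt (G.degree b)) ^ 2 / 2 := by
              rw [div_pow, Real.sq_sqrt hb.le, sq_abs]; field_simp
            rw [h1, h2]
            have : |v a| * (1 / (Real.sqrt (G.degree a) * Real.sqrt (G.degree b)) * |v b|) =
                (|v a| / Real.sqrt (G.degree a)) * (|v b| / Real.sqrt (G.degree b)) := by
              field_simp
            rw [this]
            nlinarith [sq_nonneg (|v a| / Real.sqrt (G.degree a) -
              |v b| / Real.sqrt (G.degree b))]
          · simp only [zero_mul, mul_zero, abs_zero]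
            positivity
        · simp [hab]
    _ ≤ ∑ a, v a * v a / 2 + ∑ a, v a * v a / 2 := by
        simp_rw [Finset.sum_add_distrib]
        rw [Finset.sum_comm (f := fun a b => if G.Adj b a then v b ^ 2 / (2 * G.degree b) else 0)]
        exact add_le_add (Finset.sum_le_sum fun a _ => hrow a)
          (Finset.sum_le_sum fun a _ => hrow a)
    _ = 1 := by rw [← Finset.sum_div, hv]; norm_num

/-- The column `a` of `T_k` of the truncated matrix, by the three-term recurrence. -/
noncomputable def chebColumn (a : Fin n) : ℕ → Fin n → ℝ
  | 0 => fun b => if b = a then 1 else 0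
  | 1 => fun b => ∑ c, cutoffAdjacency G low b c * (if c = a then 1 else 0)
  | k + 2 => fun b =>
      2 * (∑ c, cutoffAdjacency G low b c * chebColumn a (k + 1) c) - chebColumn a k b

/-- In the eigenvector expansion the truncated matrix multiplies the `i`-th term by its eigenvalue,
so the matrix recurrence becomes that of `T_k`. On the diagonal this exhibits the computed numbers
as moments of the local spectral measure, with weights `cutoffCoord G low i a ^ 2`. -/
theorem chebColumn_eq (a : Fin n) (k : ℕ) (b : Fin n) : chebColumn G low a k b =
    ∑ i, cutoffCoord G low i a * chebT k (cutoffEigenvalue G low i) * cutoffCoord G low i b := by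
  have step : ∀ g : Fin n → ℝ, ∀ b, ∑ c, cutoffAdjacency G low b c *
      ∑ i, cutoffCoord G low i a * g i * cutoffCoord G low i c =
      ∑ i, cutoffCoord G low i a * (cutoffEigenvalue G low i * g i) * cutoffCoord G low i b := by
    intro g b
    simp_rw [Finset.mul_sum]
    rw [Finset.sum_comm]
    refine Finset.sum_congr rfl fun i _ => ?_
    calc _ = (cutoffCoord G low i a * g i) *
          ∑ c, cutoffAdjacency G low b c * cutoffCoord G low i c := by
          rw [Finset.mul_sum]; exact Finset.sum_congr rfl fun c _ => by ring
      _ = _ := by rw [sum_cutoffAdjacency_mul]; ring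
  have h0 : ∀ c, (if c = a then (1 : ℝ) else 0) =
      ∑ i, cutoffCoord G low i a * 1 * cutoffCoord G low i c := fun c => by
    simp_rw [mul_one, eq_comm (a := c)]
    exact (sum_eigenCoord_mul' (cutoffLaplacian_isHermitian G low) a c).symm
  induction k using Nat.strong_induction_on generalizing b with
  | _ k ih =>
    match k with
    | 0 => simp only [chebColumn, chebT_zero]; exact h0 b
    | 1 =>
      simp only [chebColumn, chebT_one]
      simp_rw [h0, step, mul_one]
    | k + 2 =>
      simp only [chebColumn]
      simp_rw [ih (k + 1) (by omega), ih k (by omega), step, Finset.mul_sum,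
        ← Finset.sum_sub_distrib]
      refine Finset.sum_congr rfl fun i _ => ?_
      rw [chebT_add_two]; ring

/-- The diagonal entry `a` of `T_k` of the truncated matrix. -/
noncomputable def chebDiag (k : ℕ) (a : Fin n) : ℝ := chebColumn G low a k a

theorem sum_cutoffCoord_sq (a : Fin n) : ∑ i, cutoffCoord G low i a ^ 2 = 1 := by
  simpa [sq, cutoffCoord] using sum_eigenCoord_mul' (cutoffLaplacian_isHermitian G low) a a

theorem chebDiag_eq (k : ℕ) (a : Fin n) : chebDiag G low k a =
    ∑ i, cutoffCoord G low i a ^ 2 * chebT k (cutoffEigenvalue G low i) := by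
  rw [chebDiag, chebColumn_eq]
  exact Finset.sum_congr rfl fun i _ => by ring

theorem abs_chebDiag_le_one (k : ℕ) (a : Fin n) : |chebDiag G low k a| ≤ 1 := by
  rw [chebDiag_eq, ← sum_cutoffCoord_sq G low a]
  refine (Finset.abs_sum_le_sum_abs _ _).trans (Finset.sum_le_sum fun i _ => ?_)
  rw [abs_mul, abs_of_nonneg (sq_nonneg _)]
  exact mul_le_of_le_one_right (sq_nonneg _)
    (abs_chebT_le_one k (abs_cutoffEigenvalue_le_one G low i))

theorem sum_chebDiag (k : ℕ) :
    ∑ a, chebDiag G low k a = ∑ i, chebT k (cutoffEigenvalue G low i) := by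
  simp_rw [chebDiag_eq]
  rw [Finset.sum_comm]
  refine Finset.sum_congr rfl fun i _ => ?_
  rw [← Finset.sum_mul]
  have := sum_eigenCoord_mul (cutoffLaplacian_isHermitian G low) i i
  simp only [if_true, ← sq] at this
  exact (congrArg (· * _) this).trans (one_mul _)

end Cutoff

/-! ## The density computed from sampled diagonal entries -/

section Estimator

theorem chebyshevDensity_congr {m : ℕ} {c c' : ℕ → ℝ} (h : ∀ k < m, c k = c' k) :
    chebyshevDensity m c = chebyshevDensity m c' := by
  funext x
  unfold chebyshevDensity
  rw [Finset.sum_congr rfl fun k hk => by rw [h k (Finset.mem_range.1 hk)]]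

theorem integral_spectralMeasure {n : ℕ} {M : Matrix (Fin n) (Fin n) ℝ} (hM : M.IsHermitian)
    (f : ℝ → ℝ) :
    ∫ x, f x ∂(spectralMeasure hM) = (n : ℝ)⁻¹ * ∑ i, f (hM.eigenvalues i) := by
  rw [spectralMeasure, integral_smul_measure, integral_finsetSum_measure]
  · simp [integral_dirac]
  · intro i _
    exact integrable_dirac (by simp [enorm])

variable {n : ℕ} (G : SimpleGraph (Fin n)) (low : Fin n → Prop)

/-- The mean of the diagonal entries of `T_k` over the first `l` sampled vertices. -/
noncomputable def sampleMoment (l : ℕ) (v : ℕ → Fin n) (k : ℕ) : ℝ :=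
  (∑ j ∈ Finset.range l, chebDiag G low k (v j)) / l

/-- The weight of the `i`-th eigenvalue in the mean of the sampled local spectral measures. -/
noncomputable def sampleWeight (l : ℕ) (v : ℕ → Fin n) (i : Fin n) : ℝ :=
  (∑ j ∈ Finset.range l, cutoffCoord G low i (v j) ^ 2) / l

/-- The Chebyshev coefficients of the smoothed empirical spectral density. -/
noncomputable def sampleCoeff (N l : ℕ) (v : ℕ → Fin n) (k : ℕ) : ℝ :=
  fejerCoeff N k * sampleMoment G low l v k

theorem sampleMoment_eq (l : ℕ) (v : ℕ → Fin n) (k : ℕ) : sampleMoment G low l v k =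
    ∑ i, sampleWeight G low l v i * chebT k (cutoffEigenvalue G low i) := by
  simp_rw [sampleMoment, sampleWeight, chebDiag_eq, div_mul_eq_mul_div, ← Finset.sum_div]
  rw [Finset.sum_comm]
  simp_rw [Finset.sum_mul]

theorem sampleWeight_nonneg (l : ℕ) (v : ℕ → Fin n) (i : Fin n) :
    0 ≤ sampleWeight G low l v i := by
  unfold sampleWeight; positivity

theorem sum_sampleWeight {l : ℕ} (hl : 0 < l) (v : ℕ → Fin n) :
    ∑ i, sampleWeight G low l v i = 1 := by
  simp_rw [sampleWeight, ← Finset.sum_div]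
  rw [Finset.sum_comm]
  simp_rw [sum_cutoffCoord_sq]
  have : (l : ℝ) ≠ 0 := by positivity
  simp [this]

/-- The output series is a convex combination of Fejér kernels centred at eigenvalues in `[-1, 1]`.
Nonnegativity and total mass one thus hold for every sample, with no error to repair. -/
theorem sum_sampleCoeff_mul_chebT (N l : ℕ) (v : ℕ → Fin n) (y : ℝ) :
    ∑ k ∈ Finset.range N, sampleCoeff G low N l v k * chebT k y =
      ∑ i, sampleWeight G low l v i * fejerKernel N (cutoffEigenvalue G low i) y := by
  simp_rw [fejerKernel, Finset.mul_sum]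
  rw [Finset.sum_comm]
  refine Finset.sum_congr rfl fun k _ => ?_
  rw [sampleCoeff, sampleMoment_eq, Finset.mul_sum, Finset.sum_mul]
  exact Finset.sum_congr rfl fun i _ => by ring

theorem sum_sampleCoeff_mul_chebT_nonneg (N l : ℕ) (v : ℕ → Fin n) {y : ℝ} (hy : |y| ≤ 1) :
    0 ≤ ∑ k ∈ Finset.range N, sampleCoeff G low N l v k * chebT k y := by
  rw [sum_sampleCoeff_mul_chebT]
  exact Finset.sum_nonneg fun i _ => mul_nonneg (sampleWeight_nonneg G low l v i)
    (fejerKernel_nonneg N (abs_cutoffEigenvalue_le_one G low i) hy)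

theorem arcMean_sum_sampleCoeff {N l : ℕ} (hN : 0 < N) (hl : 0 < l) (v : ℕ → Fin n) :
    arcMean (fun y => ∑ k ∈ Finset.range N, sampleCoeff G low N l v k * chebT k y) = 1 := by
  simp_rw [sum_sampleCoeff_mul_chebT]
  rw [arcMean_sum _ fun i _ => by fun_prop]
  simp_rw [arcMean_const_mul]
  rw [← sum_sampleWeight G low hl v]
  refine Finset.sum_congr rfl fun i _ => ?_
  rw [arcMean_fejerKernel hN, mul_one]

theorem isDensity_sampleCoeff {N l : ℕ} (hN : 0 < N) (hl : 0 < l) (v : ℕ → Fin n) :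
    IsDensity (chebyshevDensity N (sampleCoeff G low N l v)) :=
  isDensity_chebyshevDensity (fun _ hy => sum_sampleCoeff_mul_chebT_nonneg G low N l v hy)
    (arcMean_sum_sampleCoeff G low hN hl v)

/-- The mean of the diagonal entries of `T_k` over all vertices. -/
noncomputable def meanMoment (k : ℕ) : ℝ := (∑ a, chebDiag G low k a) / n

/-- The three sources of error add up: `2Nη` from the moments, `t` from the smoothing and `t` from
the truncation of the matrix. -/
theorem W1_sampleCoeff_le (hn : 0 < n) {N l : ℕ} (hN : 2 < N) (hl : 0 < l) (v : ℕ → Fin n)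
    {η t : ℝ} (ht : 0 < t) (hNt : 1 ≤ N * t ^ 2)
    (hclose : ∀ k < N, |sampleMoment G low l v k - meanMoment G low k| ≤ η)
    (hfrob : ∑ a, ∑ b, (normalizedLaplacian G a b - cutoffLaplacian G low a b) ^ 2 ≤
      n * t ^ 2) :
    W1 (densityMeasure (chebyshevDensity N (sampleCoeff G low N l v)))
      (spectralMeasure (normalizedLaplacian_isHermitian G)) ≤
      ENNReal.ofReal (2 * N * η + 2 * t) := by
  have hn' : (0 : ℝ) < n := by exact_mod_cast hn
  refine iSup₂_le fun f hf => ENNReal.ofReal_le_ofReal ?_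
  set g : ℝ → ℝ := fun y => f (1 - y) with hg
  have hgl : LipschitzWith 1 g := LipschitzWith.of_dist_le_mul fun x y => by
    have := hf.dist_le_mul (1 - x) (1 - y)
    rwa [dist_sub_left] at this
  have hgc : Continuous g := hgl.continuous
  rw [integral_densityMeasure fun y hy => sum_sampleCoeff_mul_chebT_nonneg G low N l v hy,
    integral_spectralMeasure]
  set x := cutoffEigenvalue G low
  set c := sampleCoeff G low N l v
  set d : ℕ → ℝ := fun k => fejerCoeff N k * meanMoment G low k
  have hd : ∀ y, ∑ k ∈ Finset.range N, d k * chebT k y =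
      ∑ i, (n : ℝ)⁻¹ * fejerKernel N (x i) y := fun y => by
    simp_rw [fejerKernel, Finset.mul_sum]
    rw [Finset.sum_comm]
    refine Finset.sum_congr rfl fun k _ => ?_
    simp only [d]
    rw [meanMoment, sum_chebDiag, Finset.sum_div, Finset.mul_sum, Finset.sum_mul]
    exact Finset.sum_congr rfl fun i _ => by ring
  have hd1 : arcMean (fun y => ∑ k ∈ Finset.range N, d k * chebT k y) = 1 := by
    simp_rw [hd]
    rw [arcMean_sum _ fun i _ => by fun_prop]
    simp_rw [arcMean_const_mul, arcMean_fejerKernel (show 0 < N by omega)]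
    simp [hn'.ne']
  have hc1 : arcMean (fun y => ∑ k ∈ Finset.range N, c k * chebT k y) = 1 :=
    arcMean_sum_sampleCoeff G low (by omega) hl v
  have hη : 0 ≤ η := (abs_nonneg _).trans (hclose 0 (by omega))
  -- replacing the sampled moments by the exact ones
  have step1 : arcMean (fun y => g y * ∑ k ∈ Finset.range N, c k * chebT k y) ≤
      arcMean (fun y => g y * ∑ k ∈ Finset.range N, d k * chebT k y) + 2 * N * η := by
    -- Both series have mean one, so the constant `g 0` may be subtracted; on `[-1, 1]` the
    -- remaining factor is at most `1`, and each of the `N` terms of the difference at most `2η`.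
    have hdiff : arcMean (fun y => (g y - g 0) * (∑ k ∈ Finset.range N, c k * chebT k y -
        ∑ k ∈ Finset.range N, d k * chebT k y)) ≤ 2 * N * η := by
      have : 2 * N * η = arcMean (fun _ => 2 * N * η * 1) := by
        rw [arcMean_const_mul, arcMean_one, mul_one]
      rw [this]
      refine arcMean_mono (by fun_prop) (by fun_prop) fun y hy => ?_
      have h1 : |g y - g 0| ≤ 1 := by
        have := hgl.dist_le_mul y 0
        simp only [NNReal.coe_one, one_mul, Real.dist_eq, sub_zero] at this
        exact this.trans hy
      have h2 : |∑ k ∈ Finset.range N, c k * chebT k y -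
          ∑ k ∈ Finset.range N, d k * chebT k y| ≤ 2 * N * η := by
        rw [← Finset.sum_sub_distrib]
        calc _ ≤ ∑ k ∈ Finset.range N, |c k * chebT k y - d k * chebT k y| :=
              Finset.abs_sum_le_sum_abs _ _
          _ ≤ ∑ _k ∈ Finset.range N, 2 * η := by
              refine Finset.sum_le_sum fun k hk => ?_
              have hk' := Finset.mem_range.1 hk
              have : c k * chebT k y - d k * chebT k y = fejerCoeff N k *
                  (sampleMoment G low l v k - meanMoment G low k) * chebT k y := by
                simp only [c, d, sampleCoeff]; ring
              rw [this, abs_mul, abs_mul, abs_of_nonneg (fejerCoeff_nonneg N hk')]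
              calc _ ≤ 2 * η * 1 := by
                    gcongr
                    · exact fejerCoeff_le_two N
                    · exact hclose k hk'
                    · exact abs_chebT_le_one k hy
                _ = _ := mul_one _
          _ = 2 * N * η := by simp; ring
      calc _ ≤ |(g y - g 0) * (∑ k ∈ Finset.range N, c k * chebT k y -
            ∑ k ∈ Finset.range N, d k * chebT k y)| := le_abs_self _
        _ ≤ 1 * (2 * N * η) := by
            rw [abs_mul]; exact mul_le_mul h1 h2 (abs_nonneg _) zero_le_one
        _ = _ := by ring
    have : (fun y => (g y - g 0) * (∑ k ∈ Finset.range N, c k * chebT k y -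
        ∑ k ∈ Finset.range N, d k * chebT k y)) = fun y =>
        (g y * ∑ k ∈ Finset.range N, c k * chebT k y -
          g y * ∑ k ∈ Finset.range N, d k * chebT k y) -
        (g 0 * ∑ k ∈ Finset.range N, c k * chebT k y -
          g 0 * ∑ k ∈ Finset.range N, d k * chebT k y) := by
      funext y; ring
    rw [this, arcMean_sub (by fun_prop) (by fun_prop), arcMean_sub (by fun_prop) (by fun_prop),
      arcMean_sub (by fun_prop) (by fun_prop), arcMean_const_mul, arcMean_const_mul, hc1,
      hd1] at hdiff
    linarith
  -- smoothing
  have step2 : arcMean (fun y => g y * ∑ k ∈ Finset.range N, d k * chebT k y) ≤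
      (n : ℝ)⁻¹ * ∑ i, g (x i) + t := by
    have : (fun y => g y * ∑ k ∈ Finset.range N, d k * chebT k y) = fun y =>
        ∑ i, (n : ℝ)⁻¹ * (g y * fejerKernel N (x i) y) := by
      funext y
      rw [hd, Finset.mul_sum]
      exact Finset.sum_congr rfl fun i _ => by ring
    rw [this, arcMean_sum _ fun i _ => by fun_prop]
    simp_rw [arcMean_const_mul]
    calc _ ≤ ∑ i, (n : ℝ)⁻¹ * (g (x i) + t) := by
          refine Finset.sum_le_sum fun i _ => ?_
          gcongr
          exact arcMean_mul_fejerKernel_le hN hgl (abs_cutoffEigenvalue_le_one G low i) ht hNt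
      _ = _ := by
          rw [← Finset.mul_sum, Finset.sum_add_distrib]
          simp only [Finset.sum_const, Finset.card_univ, Fintype.card_fin, nsmul_eq_mul]
          field_simp
  -- comparing the two spectra
  have step3 : (n : ℝ)⁻¹ * ∑ i, g (x i) ≤
      (n : ℝ)⁻¹ * ∑ i, f ((normalizedLaplacian_isHermitian G).eigenvalues i) + t := by
    have h := sum_eigenvalues_sub_le (cutoffLaplacian_isHermitian G low)
      (normalizedLaplacian_isHermitian G) hf ht (by
        refine le_trans (le_of_eq ?_) hfrob
        exact Finset.sum_congr rfl fun a _ => Finset.sum_congr rfl fun b _ => by ring)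
    have hx : ∀ i, g (x i) = f ((cutoffLaplacian_isHermitian G low).eigenvalues i) := fun i => by
      simp only [hg, x, cutoffEigenvalue, sub_sub_cancel]
    simp_rw [hx]
    calc _ ≤ (n : ℝ)⁻¹ * (∑ i, f ((normalizedLaplacian_isHermitian G).eigenvalues i) + n * t) := by
          gcongr; linarith
      _ = _ := by field_simp
  linarith

end Estimator

/-! ## Concentration of sample means -/

section Concentration

/-- The expectation of a nonnegative function under a discrete distribution. -/
noncomputable def expect {α : Type*} (p : PMF α) (F : α → ℝ≥0∞) : ℝ≥0∞ := ∑' a, p a * F a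

theorem expect_pure {α : Type*} (a : α) (F : α → ℝ≥0∞) : expect (PMF.pure a) F = F a := by
  classical
  rw [expect, tsum_eq_single a]
  · simp
  · intro b hb; simp [PMF.pure_apply, hb]

theorem expect_bind {α β : Type*} (p : PMF α) (q : α → PMF β) (F : β → ℝ≥0∞) :
    expect (p.bind q) F = expect p fun a => expect (q a) F := by
  simp_rw [expect, PMF.bind_apply, ← ENNReal.tsum_mul_right, ← ENNReal.tsum_mul_left]
  rw [ENNReal.tsum_comm]
  simp_rw [mul_assoc]

theorem expect_map {α β : Type*} (p : PMF α) (f : α → β) (F : β → ℝ≥0∞) :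
    expect (p.map f) F = expect p fun a => F (f a) := by
  rw [PMF.map, expect_bind]
  simp [expect_pure]

theorem expect_mul_const {α : Type*} (p : PMF α) (F : α → ℝ≥0∞) (c : ℝ≥0∞) :
    expect p (fun a => F a * c) = expect p F * c := by
  simp_rw [expect, ← mul_assoc, ENNReal.tsum_mul_right]

/-- Markov's inequality for discrete distributions. -/
theorem toOuterMeasure_le_expect {α : Type*} (p : PMF α) (S : Set α) {F : α → ℝ≥0∞}
    (h : ∀ a ∈ S, 1 ≤ F a) : p.toOuterMeasure S ≤ expect p F := by
  rw [PMF.toOuterMeasure_apply]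
  refine ENNReal.tsum_le_tsum fun a => ?_
  by_cases ha : a ∈ S
  · rw [Set.indicator_of_mem ha]
    exact le_mul_of_one_le_right' (h a ha)
  · simp [ha]

theorem one_le_toOuterMeasure_add_compl {α : Type*} (p : PMF α) (S : Set α) :
    1 ≤ p.toOuterMeasure S + p.toOuterMeasure Sᶜ := by
  have h1 : p.toOuterMeasure (S ∪ Sᶜ) = 1 := by
    rw [PMF.toOuterMeasure_apply_eq_one_iff, Set.union_compl_self]
    exact Set.subset_univ _
  rw [← h1]
  exact measure_union_le S Sᶜ

variable {n : ℕ} [NeZero n]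

/-- The distribution of a sequence whose first `l` entries are independent and uniform. -/
noncomputable def draws (n : ℕ) [NeZero n] : ℕ → PMF (ℕ → Fin n)
  | 0 => PMF.pure fun _ => 0
  | l + 1 => (draws n l).bind fun v =>
      (PMF.uniformOfFintype (Fin n)).map fun a => Function.update v l a

theorem expect_draws_prod (F : Fin n → ℝ≥0∞) (l : ℕ) :
    expect (draws n l) (fun v => ∏ j ∈ Finset.range l, F (v j)) =
      expect (PMF.uniformOfFintype (Fin n)) F ^ l := by
  induction l with
  | zero => simp [draws, expect_pure]
  | succ l ih =>
    rw [draws, expect_bind, pow_succ, ← ih, ← expect_mul_const]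
    congr 1
    funext v
    rw [expect_map, mul_comm, ← expect_mul_const]
    congr 1
    funext a
    rw [Finset.prod_range_succ, Function.update_self, mul_comm]
    congr 1
    refine Finset.prod_congr rfl fun j hj => ?_
    rw [Function.update_of_ne (Finset.mem_range.1 hj).ne]

theorem expect_uniform (F : Fin n → ℝ) (hF : ∀ a, 0 ≤ F a) :
    expect (PMF.uniformOfFintype (Fin n)) (fun a => ENNReal.ofReal (F a)) =
      ENNReal.ofReal ((∑ a, F a) / n) := by
  have hn : (0 : ℝ) < n := by exact_mod_cast Nat.pos_of_ne_zero (NeZero.ne n)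
  rw [expect, tsum_fintype]
  simp_rw [PMF.uniformOfFintype_apply, ← Finset.mul_sum]
  rw [← ENNReal.ofReal_sum_of_nonneg fun a _ => hF a, ENNReal.ofReal_div_of_pos hn,
    div_eq_mul_inv, mul_comm, Fintype.card_fin, ENNReal.ofReal_natCast]

/-- The centred variable is at most `2` in absolute value, so `exp z ≤ 1 + z + z²` applies with `|z|
≤ 2s ≤ 1`, and the linear term averages to zero. -/
theorem sum_exp_div_le {X : Fin n → ℝ} (hX : ∀ a, |X a| ≤ 1) {s : ℝ} (hs : 0 ≤ s)
    (hs1 : 2 * s ≤ 1) :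
    (∑ a, Real.exp (s * (X a - (∑ b, X b) / n))) / n ≤ Real.exp (4 * s ^ 2) := by
  have hn : (0 : ℝ) < n := by exact_mod_cast Nat.pos_of_ne_zero (NeZero.ne n)
  set μ := (∑ b, X b) / n with hμ
  have hμ1 : |μ| ≤ 1 := by
    rw [hμ, abs_div, abs_of_pos hn, div_le_one hn]
    calc _ ≤ ∑ a, |X a| := Finset.abs_sum_le_sum_abs _ _
      _ ≤ ∑ _a : Fin n, (1 : ℝ) := Finset.sum_le_sum fun a _ => hX a
      _ = n := by simp
  have hterm : ∀ a, Real.exp (s * (X a - μ)) ≤ 1 + s * (X a - μ) + 4 * s ^ 2 := fun a => by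
    have hd : |X a - μ| ≤ 2 := (abs_sub _ _).trans (by linarith [hX a])
    have hz : |s * (X a - μ)| ≤ 2 * s := by
      rw [abs_mul, abs_of_nonneg hs]; nlinarith
    have h1 := (abs_le.1 (Real.abs_exp_sub_one_sub_id_le (hz.trans hs1))).2
    have h2 : (s * (X a - μ)) ^ 2 ≤ (2 * s) ^ 2 := sq_le_sq' (abs_le.1 hz).1 (abs_le.1 hz).2
    linarith
  calc _ ≤ (∑ a, (1 + s * (X a - μ) + 4 * s ^ 2)) / (n : ℝ) := by
        gcongr with a; exact hterm a
    _ = 1 + 4 * s ^ 2 := by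
        rw [Finset.sum_add_distrib, Finset.sum_add_distrib, ← Finset.mul_sum,
          Finset.sum_sub_distrib]
        simp only [Finset.sum_const, Finset.card_univ, Fintype.card_fin, nsmul_eq_mul]
        rw [hμ]
        field_simp
        ring
    _ ≤ _ := by rw [add_comm]; exact Real.add_one_le_exp _

theorem draws_upper_tail {X : Fin n → ℝ} (hX : ∀ a, |X a| ≤ 1) {η : ℝ} (hη : 0 < η)
    (hη1 : η ≤ 1) {l : ℕ} (hl : 0 < l) :
    (draws n l).toOuterMeasure
        {v | η < (∑ j ∈ Finset.range l, X (v j)) / l - (∑ a, X a) / n} ≤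
      ENNReal.ofReal (Real.exp (-(l * (η ^ 2 / 16)))) := by
  have hl' : (0 : ℝ) < l := by exact_mod_cast hl
  set μ := (∑ a, X a) / n with hμ
  -- The Chernoff parameter is `s = η/8`: the `l` moment factors cost `4 s² l = l η²/16` in the
  -- exponent and the deviation gains `s η l = l η²/8`.
  set F : Fin n → ℝ≥0∞ := fun a => ENNReal.ofReal (Real.exp (η / 8 * (X a - μ)))
  set c : ℝ≥0∞ := ENNReal.ofReal (Real.exp (-(l * (η ^ 2 / 8))))
  have hmarkov := toOuterMeasure_le_expect (draws n l)
    {v | η < (∑ j ∈ Finset.range l, X (v j)) / l - μ}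
    (F := fun v => (∏ j ∈ Finset.range l, F (v j)) * c) (by
      intro v hv
      simp only [F, c]
      rw [← ENNReal.ofReal_prod_of_nonneg fun _ _ => (Real.exp_pos _).le, ← Real.exp_sum,
        ← ENNReal.ofReal_mul (Real.exp_pos _).le, ← Real.exp_add, ENNReal.one_le_ofReal,
        Real.one_le_exp_iff, ← Finset.mul_sum, Finset.sum_sub_distrib]
      have h1 : η * l < ∑ j ∈ Finset.range l, X (v j) - l * μ := by
        have : η < (∑ j ∈ Finset.range l, X (v j)) / l - μ := hv
        have h2 : (∑ j ∈ Finset.range l, X (v j)) / l - μ =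
          (∑ j ∈ Finset.range l, X (v j) - l * μ) / l := by field_simp
        rwa [h2, lt_div_iff₀ hl'] at this
      simp only [Finset.sum_const, Finset.card_range, nsmul_eq_mul]
      nlinarith)
  refine hmarkov.trans ?_
  rw [expect_mul_const, expect_draws_prod, expect_uniform _ fun _ => (Real.exp_pos _).le]
  calc _ ≤ ENNReal.ofReal (Real.exp (4 * (η / 8) ^ 2)) ^ l * c := by
        gcongr
        exact sum_exp_div_le hX (by positivity) (by linarith)
    _ = _ := by
        rw [← ENNReal.ofReal_pow (Real.exp_pos _).le, ← Real.exp_nat_mul,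
          ← ENNReal.ofReal_mul (Real.exp_pos _).le, ← Real.exp_add]
        congr 2
        ring

theorem draws_tail {X : Fin n → ℝ} (hX : ∀ a, |X a| ≤ 1) {η : ℝ} (hη : 0 < η)
    (hη1 : η ≤ 1) {l : ℕ} (hl : 0 < l) :
    (draws n l).toOuterMeasure
        {v | η < |(∑ j ∈ Finset.range l, X (v j)) / l - (∑ a, X a) / n|} ≤
      ENNReal.ofReal (2 * Real.exp (-(l * (η ^ 2 / 16)))) := by
  have h1 := draws_upper_tail hX hη hη1 hl
  have h2 := draws_upper_tail (X := fun a => -X a) (fun a => by rw [abs_neg]; exact hX a)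
    hη hη1 hl
  rw [two_mul, ENNReal.ofReal_add (Real.exp_pos _).le (Real.exp_pos _).le]
  refine le_trans (measure_mono ?_) ((measure_union_le _ _).trans (add_le_add h1 h2))
  intro v hv
  simp only [Finset.sum_neg_distrib, neg_div, Set.mem_union, Set.mem_ofPred_eq] at hv ⊢
  rcases lt_abs.1 hv with h | h
  · exact Or.inl h
  · right; linarith

/-- Simultaneous concentration of the sample means of finitely many bounded functions. -/
theorem draws_uniform_tail {N : ℕ} {X : ℕ → Fin n → ℝ} (hX : ∀ k a, |X k a| ≤ 1) {η δ : ℝ}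
    (hη : 0 < η) (hη1 : η ≤ 1) {l : ℕ} (hl : 0 < l)
    (hδ : 2 * N * Real.exp (-(l * (η ^ 2 / 16))) ≤ δ) :
    ENNReal.ofReal (1 - δ) ≤ (draws n l).toOuterMeasure
      {v | ∀ k < N, |(∑ j ∈ Finset.range l, X k (v j)) / l - (∑ a, X k a) / n| ≤ η} := by
  set S := {v : ℕ → Fin n |
    ∀ k < N, |(∑ j ∈ Finset.range l, X k (v j)) / l - (∑ a, X k a) / n| ≤ η}
  have hδ0 : 0 ≤ δ := le_trans (by positivity) hδ
  have hbad : (draws n l).toOuterMeasure Sᶜ ≤ ENNReal.ofReal δ := by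
    calc _ ≤ (draws n l).toOuterMeasure (⋃ k ∈ Finset.range N,
            {v | η < |(∑ j ∈ Finset.range l, X k (v j)) / l - (∑ a, X k a) / n|}) := by
          refine measure_mono fun v hv => ?_
          simp only [S, Set.mem_compl_iff, Set.mem_ofPred_eq] at hv
          push Not at hv
          obtain ⟨k, hk, h⟩ := hv
          simp only [Set.mem_iUnion]
          exact ⟨k, Finset.mem_range.2 hk, h⟩
      _ ≤ ∑ k ∈ Finset.range N, (draws n l).toOuterMeasure
            {v | η < |(∑ j ∈ Finset.range l, X k (v j)) / l - (∑ a, X k a) / n|} :=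
          measure_biUnion_finset_le _ _
      _ ≤ ∑ _k ∈ Finset.range N, ENNReal.ofReal (2 * Real.exp (-(l * (η ^ 2 / 16)))) :=
          Finset.sum_le_sum fun k _ => draws_tail (hX k) hη hη1 hl
      _ = ENNReal.ofReal (2 * N * Real.exp (-(l * (η ^ 2 / 16)))) := by
          rw [Finset.sum_const, Finset.card_range, nsmul_eq_mul, ← ENNReal.ofReal_natCast,
            ← ENNReal.ofReal_mul (by positivity)]
          congr 1; ring
      _ ≤ _ := ENNReal.ofReal_le_ofReal hδ
  rw [ENNReal.ofReal_sub _ hδ0, ENNReal.ofReal_one, tsub_le_iff_right]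
  exact (one_le_toOuterMeasure_add_compl _ S).trans (by gcongr)

end Concentration

/-! ## Reasoning about programs -/

namespace RAM

section Logic

theorem expect_const {α : Type*} (p : PMF α) (c : ℝ≥0∞) : expect p (fun _ => c) = c := by
  rw [expect, ENNReal.tsum_mul_right, p.tsum_coe, one_mul]

theorem expect_mono {α : Type*} (p : PMF α) {F F' : α → ℝ≥0∞} (h : ∀ a, F a ≤ F' a) :
    expect p F ≤ expect p F' :=
  ENNReal.tsum_le_tsum fun a => by gcongr; exact h a

theorem toOuterMeasure_le_one {α : Type*} (p : PMF α) (S : Set α) : p.toOuterMeasure S ≤ 1 := by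
  refine (toOuterMeasure_le_expect p S (F := fun _ => 1) fun _ _ => le_rfl).trans ?_
  rw [expect_const]

theorem unif_range (n : ℕ) [NeZero n] :
    unif (Finset.range n) = (PMF.uniformOfFintype (Fin n)).map Fin.val := by
  have hne : (Finset.range n).Nonempty := Finset.nonempty_range_iff.2 (NeZero.ne n)
  ext k
  rw [unif, dif_pos hne, PMF.uniformOfFinset_apply, PMF.map_apply, tsum_fintype]
  by_cases hk : k < n
  · rw [if_pos (Finset.mem_range.2 hk), Finset.sum_eq_single ⟨k, hk⟩]
    · simp
    · intro b _ hb
      rw [if_neg]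
      rintro rfl
      exact hb rfl
    · simp
  · rw [if_neg (by simpa using hk)]
    refine (Finset.sum_eq_zero fun b _ => if_neg ?_).symm
    rintro rfl
    exact hk b.2

variable {n : ℕ} {adj : ℕ → List ℕ}

theorem run_add (c : Config) (a b : ℕ) :
    run n adj c (a + b) = (run n adj c a).bind fun c' => run n adj c' b := by
  induction b with
  | zero => simp [run]
  | succ b ih => rw [← add_assoc, run, ih, PMF.bind_bind]; rfl

theorem run_halted (s : State) (t T : ℕ) :
    run n adj ⟨[], s, t⟩ T = PMF.pure ⟨[], s, t⟩ := by
  induction T with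
  | zero => rfl
  | succ T ih => rw [run, ih, PMF.pure_bind]; rfl

theorem run_one (c : Config) : run n adj c 1 = step n adj c := by
  simp [run]

theorem time_le_expect_step (c : Config) :
    (c.time : ℝ≥0∞) ≤ expect (step n adj c) fun c' => (c'.time : ℝ≥0∞) := by
  rcases c with ⟨_ | ⟨c, K⟩, s, t⟩
  · simp [step, expect_pure]
  · cases c <;> simp only [step, expect_pure, expect_map, expect_const, Nat.cast_le] <;> omega

/-- The clock never runs backwards, so the supremum defining the expected time is controlled by the
times `T` at which all runs have halted. -/
theorem expect_time_run_mono (c : Config) :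
    Monotone fun T => expect (run n adj c T) fun c' => (c'.time : ℝ≥0∞) :=
  monotone_nat_of_le_succ fun T => by
    rw [run, expect_bind]
    exact expect_mono _ time_le_expect_step

/-! ### Deterministic executions and total correctness -/

/-- `c` takes the state `s` to the state `s'` without random choices in time `t`. -/
def Exec (n : ℕ) (adj : ℕ → List ℕ) (c : Cmd) (s s' : State) (t : ℕ) : Prop :=
  ∃ m ≤ t, ∀ K t₀, run n adj ⟨c :: K, s, t₀⟩ m = PMF.pure ⟨K, s', t₀ + t⟩

theorem Exec.of_step {c : Cmd} {s s' : State} {t : ℕ} (ht : 1 ≤ t)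
    (h : ∀ K t₀, step n adj ⟨c :: K, s, t₀⟩ = PMF.pure ⟨K, s', t₀ + t⟩) :
    Exec n adj c s s' t :=
  ⟨1, ht, fun K t₀ => by rw [run_one, h]⟩

theorem Exec.seq {c d : Cmd} {s s' s'' : State} {t t' : ℕ} (h : Exec n adj c s s' t)
    (h' : Exec n adj d s' s'' t') : Exec n adj (.seq c d) s s'' (t + t' + 1) := by
  obtain ⟨m, hm, h⟩ := h
  obtain ⟨m', hm', h'⟩ := h'
  refine ⟨1 + m + m', by omega, fun K t₀ => ?_⟩
  rw [run_add, run_add, run_one, step, PMF.pure_bind, h, PMF.pure_bind, h']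
  congr 2; omega

theorem Exec.of_pure_step {c d : Cmd} {s s' : State} {t t' : ℕ} (ht : 1 ≤ t)
    (h : ∀ K t₀, step n adj ⟨c :: K, s, t₀⟩ = PMF.pure ⟨d :: K, s, t₀ + t⟩)
    (h' : Exec n adj d s s' t') : Exec n adj c s s' (t + t') := by
  obtain ⟨m', hm', h'⟩ := h'
  refine ⟨1 + m', by omega, fun K t₀ => ?_⟩
  rw [run_add, run_one, h, PMF.pure_bind, h', add_assoc]

theorem Exec.while_false {b : BExp} {c : Cmd} {s : State} (hb : ¬ b.eval s) :
    Exec n adj (.while b c) s s (b.cost + 1) :=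
  .of_step (by omega) fun K t₀ => by rw [step, if_neg hb, add_assoc]

theorem Exec.while_true {b : BExp} {c : Cmd} {s s' s'' : State} {t t' : ℕ} (hb : b.eval s)
    (h : Exec n adj c s s' t) (h' : Exec n adj (.while b c) s' s'' t') :
    Exec n adj (.while b c) s s'' (b.cost + 1 + t + t') := by
  obtain ⟨m, hm, h⟩ := h
  obtain ⟨m', hm', h'⟩ := h'
  refine ⟨1 + m + m', by omega, fun K t₀ => ?_⟩
  rw [run_add, run_add, run_one, step, if_pos hb, PMF.pure_bind, h, PMF.pure_bind, h']
  congr 2; omega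

/-- Total correctness: started in `s`, the command `c` ends without random choices within time
`B` in a state satisfying `Q`. -/
def Ends (n : ℕ) (adj : ℕ → List ℕ) (c : Cmd) (s : State) (B : ℕ) (Q : State → Prop) : Prop :=
  ∃ s' t, t ≤ B ∧ Exec n adj c s s' t ∧ Q s'

theorem Ends.mono {c : Cmd} {s : State} {B B' : ℕ} {Q Q' : State → Prop}
    (h : Ends n adj c s B Q) (hB : B ≤ B') (hQ : ∀ s', Q s' → Q' s') : Ends n adj c s B' Q' := by
  obtain ⟨s', t, ht, he, hq⟩ := h
  exact ⟨s', t, ht.trans hB, he, hQ s' hq⟩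

theorem Ends.skip {s : State} {Q : State → Prop} (h : Q s) : Ends n adj .skip s 1 Q :=
  ⟨_, _, le_rfl, .of_step le_rfl fun _ _ => rfl, h⟩

theorem Ends.iset {x : ℕ} {e : IExp} {s : State} {Q : State → Prop}
    (h : Q (s.setI x (e.eval s))) : Ends n adj (.iset x e) s (e.cost + 1) Q :=
  ⟨_, _, le_rfl, .of_step (by omega) fun _ _ => rfl, h⟩

theorem Ends.rset {x : ℕ} {e : RExp} {s : State} {Q : State → Prop}
    (h : Q (s.setR x (e.eval s))) : Ends n adj (.rset x e) s (e.cost + 1) Q :=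
  ⟨_, _, le_rfl, .of_step (by omega) fun _ _ => rfl, h⟩

theorem Ends.rput {a : ℕ} {i : IExp} {e : RExp} {s : State} {Q : State → Prop}
    (h : Q (s.putR a (i.eval s) (e.eval s))) :
    Ends n adj (.rput a i e) s (i.cost + e.cost + 1) Q :=
  ⟨_, _, le_rfl, .of_step (by omega) fun K t₀ => by
    rw [step]; congr 2; omega, h⟩

theorem Ends.degree {x : ℕ} {v : IExp} {s : State} {Q : State → Prop}
    (h : Q (s.setI x (adj (v.eval s)).length)) :
    Ends n adj (.degree x v) s (v.cost + 1) Q :=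
  ⟨_, _, le_rfl, .of_step (by omega) fun _ _ => rfl, h⟩

theorem Ends.readNbrs {a : ℕ} {v : IExp} {s : State} {Q : State → Prop} {d : ℕ}
    (hd : (adj (v.eval s)).length ≤ d) (h : Q (s.putList a (adj (v.eval s)))) :
    Ends n adj (.readNbrs a v) s (v.cost + d + 1) Q :=
  ⟨_, v.cost + (adj (v.eval s)).length + 1, by omega, .of_step (by omega) fun K t₀ => by
    rw [step]; congr 2; omega, h⟩

theorem Ends.seq {c d : Cmd} {s : State} {B B' : ℕ} {Q : State → Prop}
    (h : Ends n adj c s B fun s' => Ends n adj d s' B' Q) :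
    Ends n adj (.seq c d) s (B + B' + 1) Q := by
  obtain ⟨s', t, ht, he, s'', t', ht', he', hq⟩ := h
  exact ⟨s'', _, by omega, he.seq he', hq⟩

theorem Ends.ite {b : BExp} {c d : Cmd} {s : State} {B : ℕ} {Q : State → Prop}
    (hc : b.eval s → Ends n adj c s B Q) (hd : ¬ b.eval s → Ends n adj d s B Q) :
    Ends n adj (.ite b c d) s (b.cost + 1 + B) Q := by
  by_cases hb : b.eval s
  · obtain ⟨s', t, ht, he, hq⟩ := hc hb
    exact ⟨s', _, Nat.add_le_add_left ht _, .of_pure_step (by omega)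
      (fun K t₀ => by rw [step, if_pos hb, add_assoc]) he, hq⟩
  · obtain ⟨s', t, ht, he, hq⟩ := hd hb
    exact ⟨s', _, Nat.add_le_add_left ht _, .of_pure_step (by omega)
      (fun K t₀ => by rw [step, if_neg hb, add_assoc]) he, hq⟩

/-- A loop with invariant `I` that is left after exactly `N` rounds. -/
theorem Ends.while {b : BExp} {c : Cmd} {s : State} {N B : ℕ} (I : ℕ → State → Prop)
    (h0 : I 0 s) (hb : ∀ i ≤ N, ∀ s, I i s → (b.eval s ↔ i < N))
    (hc : ∀ i < N, ∀ s, I i s → Ends n adj c s B (I (i + 1))) :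
    Ends n adj (.while b c) s (N * (b.cost + 1 + B) + (b.cost + 1)) (I N) := by
  have key : ∀ k i s, i + k = N → I i s →
      Ends n adj (.while b c) s (k * (b.cost + 1 + B) + (b.cost + 1)) (I N) := by
    intro k
    induction k with
    | zero =>
      intro i s hi hI
      obtain rfl : i = N := by omega
      have hnb : ¬ b.eval s := fun h => lt_irrefl _ ((hb i le_rfl s hI).1 h)
      exact ⟨s, _, by omega, .while_false hnb, hI⟩
    | succ k ih =>
      intro i s hi hI
      have hbt : b.eval s := (hb i (by omega) s hI).2 (by omega)
      obtain ⟨s', t, ht, he, hI'⟩ := hc i (by omega) s hI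
      obtain ⟨s'', t', ht', he', hq⟩ := ih (i + 1) s' (by omega) hI'
      refine ⟨s'', _, ?_, .while_true hbt he he', hq⟩
      rw [Nat.succ_mul]; omega
  exact key N 0 s (by omega) h0

/-- `for x = 0, 1, … while b do c`. -/
def forLoop (x : ℕ) (b : BExp) (c : Cmd) : Cmd :=
  .seq (.iset x (.const 0)) (.while b (.seq c (.iset x (.add (.var x) (.const 1)))))

/-- A counting loop: the invariant `I` of the loop holds before the counter is increased. -/
theorem Ends.forLoop {x : ℕ} {b : BExp} {c : Cmd} {s : State} {N B : ℕ} (I : ℕ → State → Prop)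
    (h0 : I 0 (s.setI x 0))
    (hb : ∀ i ≤ N, ∀ s, I i s → (b.eval s ↔ i < N))
    (hc : ∀ i < N, ∀ s, I i s → Ends n adj c s B fun s' =>
      s'.ivar x = i ∧ I (i + 1) (s'.setI x (i + 1))) :
    Ends n adj (forLoop x b c) s (N * (b.cost + B + 6) + b.cost + 4) (I N) := by
  refine (Ends.seq (Ends.iset (Ends.while I h0 hb (B := B + 5) ?_))).mono ?_ fun _ h => h
  · intro i hi s hI
    refine (Ends.seq ((hc i hi s hI).mono le_rfl ?_)).mono le_rfl fun _ h => h
    rintro s' ⟨h1, h2⟩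
    refine Ends.iset ?_
    simpa only [IExp.eval, h1] using h2
  · simp only [IExp.cost]
    have : b.cost + 1 + (B + 5) = b.cost + B + 6 := by ring
    rw [this]; omega

/-! ### Loops with random bodies -/

/-- The iterates of a random loop body with effect `e` on the sequence `v` of random choices. -/
def iterState {n : ℕ} (e : State → Fin n → State) (s : State) (v : ℕ → Fin n) : ℕ → State
  | 0 => s
  | j + 1 => e (iterState e s v j) (v j)

theorem iterState_update {n : ℕ} (e : State → Fin n → State) (s : State) (v : ℕ → Fin n)
    {j l : ℕ} (hj : j ≤ l) (a : Fin n) :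
    iterState e s (Function.update v l a) j = iterState e s v j := by
  induction j with
  | zero => rfl
  | succ j ih =>
    rw [iterState, ih (by omega), Function.update_of_ne (by omega)]; rfl

/-- Every round takes the same number of steps and the same time, whatever vertex is drawn, and the
loop test succeeds along every sequence of draws for `l` rounds. All runs therefore stay
synchronized, and the law of the configuration is an image of `draws n l`. -/
theorem run_random_while [NeZero n] {b : BExp} {c : Cmd} {m τ : ℕ}
    (e : State → Fin n → State)
    (hc : ∀ K s t, run n adj ⟨c :: K, s, t⟩ m =
      (PMF.uniformOfFintype (Fin n)).map fun a => ⟨K, e s a, t + τ⟩)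
    {s : State} {l : ℕ} (hb : ∀ j < l, ∀ v, b.eval (iterState e s v j)) (K : List Cmd) (t : ℕ) :
    run n adj ⟨.while b c :: K, s, t⟩ (l * (1 + m)) =
      (draws n l).map fun v =>
        ⟨.while b c :: K, iterState e s v l, t + l * (b.cost + 1 + τ)⟩ := by
  induction l with
  | zero => simp [run, draws, iterState, PMF.pure_map]
  | succ l ih =>
    rw [Nat.succ_mul, run_add, ih fun j hj => hb j (by omega), PMF.bind_map, draws, PMF.map_bind]
    congr 1
    funext v
    simp only [Function.comp_apply]
    rw [run_add, run_one, step, if_pos (hb l (by omega) v), PMF.pure_bind, hc, PMF.map_comp]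
    congr 1
    funext a
    simp only [Function.comp_apply]
    rw [iterState, iterState_update e s v le_rfl, Function.update_self, Nat.succ_mul]
    congr 1
    omega

variable {G : SimpleGraph (Fin n)}

/-- If the random choices `v` lead within `m` steps to a configuration from which the program `D`
ends deterministically, then this describes the running time and the output. -/
theorem expectedTime_le_and_le_outputProb {α : Type*} (p : PMF α) {P D : Cmd} {L : AdjList G}
    {ε δ : ℝ} {m t₁ B : ℕ} {st : α → State}
    (hrun : exec P L ε δ m = p.map fun v => ⟨[D], st v, t₁⟩) {Q : α → (ℝ → ℝ) → Prop}
    (hD : ∀ v, Ends n L.lookup D (st v) B fun s => Q v s.output) :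
    expectedTime P L ε δ ≤ ((t₁ + B : ℕ) : ℝ≥0∞) ∧
      ∀ R : (ℝ → ℝ) → Prop, p.toOuterMeasure {v | ∀ q, Q v q → R q} ≤ outputProb P L ε δ R := by
  choose fs ft hft hex hQ using hD
  have hfin : ∀ T, exec P L ε δ (m + (B + T)) =
      p.map fun v => ⟨[], fs v, t₁ + ft v⟩ := by
    intro T
    unfold exec at hrun ⊢
    rw [run_add, hrun, PMF.bind_map, PMF.map]
    congr 1
    funext v
    obtain ⟨k, hk, h⟩ := hex v
    simp only [Function.comp_apply]
    -- The step count `k` varies with `v`, but it is at most the time spent, hence at most `B`. A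
    -- common number of steps thus brings all runs to a halt, and idling changes nothing.
    have : B + T = k + (B + T - k) := by have := hft v; omega
    rw [this, run_add, h, PMF.pure_bind, run_halted]
  constructor
  · refine iSup_le fun T => ?_
    have hmono := expect_time_run_mono (n := n) (adj := L.lookup)
      ⟨[P], initState n ε δ, 0⟩ (show T ≤ m + (B + T) by omega)
    refine le_trans hmono ?_
    have := hfin T
    unfold exec at this
    simp only [this, expect_map]
    refine (expect_mono p (F' := fun _ => ((t₁ + B : ℕ) : ℝ≥0∞)) fun v => ?_).trans
      (expect_const _ _).le
    exact_mod_cast Nat.add_le_add_left (hft v) t₁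
  · intro R
    refine le_trans ?_ (le_iSup _ (m + (B + 0)))
    rw [hfin, PMF.toOuterMeasure_map_apply]
    exact measure_mono fun v hv => ⟨rfl, hv _ (hQ v)⟩

theorem outputProb_le_one {P : Cmd} {L : AdjList G} {ε δ : ℝ} {R : (ℝ → ℝ) → Prop} :
    outputProb P L ε δ R ≤ 1 :=
  iSup_le fun _ => toOuterMeasure_le_one _ _

end Logic

/-! ## The program

Natural-number variables: `0` the number `n` of vertices, `1` the number `N` of Chebyshev moments,
`2` the number `l` of samples, `3` the index of a sample, `4` the sampled vertex, `6` the index of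
a moment, `5` and `7` running vertices, `8` the degree of vertex `7`, `9` the index of a neighbor,
`10` that neighbor and `11` its degree. Real variables: `0` is `ε`, `1` is `δ`, `2` is `N`, `3` and `4`
control the number of samples, `5` is the weight `1` or `2` of a moment, `6` a running sum. Natural
arrays: `0` the neighbors of a vertex, `1` the samples. Real arrays: `0` the output, `1` and `2` the
current and the previous Chebyshev column, `3` the next one. -/

section Program

/-- The vertex degree in variable `x` is low. -/
def lowTest (x : ℕ) : BExp :=
  .not (.rlt (.const 32) (.mul (.ofNat (.var x)) (.mul (.var 0) (.var 0))))

/-- Adds up one row of the product of the truncated matrix with the current column. -/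
def rowLoop : Cmd :=
  forLoop 9 (.ilt (.var 9) (.var 8))
    (.seq (.iset 10 (.get 0 (.var 9)))
      (.seq (.degree 11 (.var 10))
        (.ite (lowTest 11)
          (.rset 6 (.add (.var 6)
            (.div (.get 1 (.var 10)) (.sqrt (.mul (.ofNat (.var 8)) (.ofNat (.var 11)))))))
          .skip)))

/-- Computes one entry of the product of the truncated matrix with the current column. -/
def rowCmd : Cmd :=
  .seq (.rset 6 (.const 0))
    (.seq (.degree 8 (.var 7))
      (.ite (lowTest 8) (.seq (.readNbrs 0 (.var 7)) rowLoop) .skip))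

/-- Computes the next Chebyshev column. -/
def nextCmd : Cmd :=
  forLoop 7 (.ilt (.var 7) (.var 0))
    (.seq rowCmd (.rput 3 (.var 7) (.sub (.mul (.var 5) (.var 6)) (.get 2 (.var 7)))))

/-- Moves the current column to the previous one and the next to the current one. -/
def shiftCmd : Cmd :=
  forLoop 7 (.ilt (.var 7) (.var 0))
    (.seq (.rput 2 (.var 7) (.get 1 (.var 7))) (.rput 1 (.var 7) (.get 3 (.var 7))))

/-- Adds the contribution of the sampled vertex to all output coefficients. -/
def momentLoop : Cmd :=
  forLoop 6 (.ilt (.var 6) (.var 1))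
    (.seq
      (.rput 0 (.var 6) (.add (.get 0 (.var 6))
        (.div (.mul (.mul (.var 5) (.sub (.const 1) (.div (.ofNat (.var 6)) (.var 2))))
          (.get 1 (.var 4))) (.ofNat (.var 2)))))
      (.seq nextCmd (.seq shiftCmd (.rset 5 (.const 2)))))

/-- Clears the current and the previous column. -/
def clearCmd : Cmd :=
  forLoop 5 (.ilt (.var 5) (.var 0))
    (.seq (.rput 1 (.var 5) (.const 0)) (.rput 2 (.var 5) (.const 0)))

/-- Treats one sampled vertex. -/
def sampleCmd : Cmd :=
  .seq (.iset 4 (.get 1 (.var 3)))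
    (.seq clearCmd
      (.seq (.rput 1 (.var 4) (.const 1)) (.seq (.rset 5 (.const 1)) momentLoop)))

/-- The deterministic part of the program, run after the sampling. -/
def evalCmd : Cmd :=
  .seq (forLoop 3 (.ilt (.var 3) (.var 2)) sampleCmd) (.iset 0 (.var 1))

/-- One round of the sampling loop. -/
def drawCmd : Cmd :=
  .seq (.rset 4 (.mul (.var 4) (.var 3)))
    (.seq (.randVertex 3) (.seq (.iput 1 (.var 2) (.var 3))
      (.iset 2 (.add (.var 2) (.const 1)))))

/-- Not enough vertices have been sampled yet. -/
def drawTest : BExp := .rlt (.mul (.var 1) (.var 4)) (.mul (.const 2) (.var 2))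

/-- Computes the parameters. -/
def initCmd : Cmd :=
  .seq (forLoop 1 (.rlt (.mul (.ofNat (.var 1)) (.mul (.var 0) (.var 0))) (.const 16)) .skip)
    (.seq (.rset 2 (.ofNat (.var 1)))
      (.seq (.rset 3 (.add (.const 1) (.div (.mul (.var 0) (.var 0))
          (.mul (.const 256) (.mul (.var 2) (.var 2))))))
        (.rset 4 (.const 1))))

/-- The program. -/
def program : Cmd := .seq initCmd (.seq (.while drawTest drawCmd) evalCmd)

end Program

/-! ## Correctness of the deterministic part -/

section StateLemmas

variable (s : State) (x v a i : ℕ) (r : ℝ) (l : List ℕ)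

@[simp] theorem setI_ivar : (s.setI x v).ivar = Function.update s.ivar x v := rfl
@[simp] theorem setI_rvar : (s.setI x v).rvar = s.rvar := rfl
@[simp] theorem setI_iarr : (s.setI x v).iarr = s.iarr := rfl
@[simp] theorem setI_rarr : (s.setI x v).rarr = s.rarr := rfl
@[simp] theorem setR_ivar : (s.setR x r).ivar = s.ivar := rfl
@[simp] theorem setR_rvar : (s.setR x r).rvar = Function.update s.rvar x r := rfl
@[simp] theorem setR_iarr : (s.setR x r).iarr = s.iarr := rfl
@[simp] theorem setR_rarr : (s.setR x r).rarr = s.rarr := rfl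
@[simp] theorem putI_ivar : (s.putI a i v).ivar = s.ivar := rfl
@[simp] theorem putI_rvar : (s.putI a i v).rvar = s.rvar := rfl
@[simp] theorem putI_iarr :
    (s.putI a i v).iarr = Function.update s.iarr a (Function.update (s.iarr a) i v) := rfl
@[simp] theorem putI_rarr : (s.putI a i v).rarr = s.rarr := rfl
@[simp] theorem putR_ivar : (s.putR a i r).ivar = s.ivar := rfl
@[simp] theorem putR_rvar : (s.putR a i r).rvar = s.rvar := rfl
@[simp] theorem putR_iarr : (s.putR a i r).iarr = s.iarr := rfl
@[simp] theorem putR_rarr :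
    (s.putR a i r).rarr = Function.update s.rarr a (Function.update (s.rarr a) i r) := rfl
@[simp] theorem putList_ivar : (s.putList a l).ivar = s.ivar := rfl
@[simp] theorem putList_rvar : (s.putList a l).rvar = s.rvar := rfl
@[simp] theorem putList_iarr : (s.putList a l).iarr =
    Function.update s.iarr a (fun i => l.getD i (s.iarr a i)) := rfl
@[simp] theorem putList_rarr : (s.putList a l).rarr = s.rarr := rfl

/-- The variables numbered below `a` and `b` and the array of samples are the same in `s` and
`s'`. -/
structure Keep (a b : ℕ) (s s' : State) : Prop where
  ivar : ∀ x < a, s'.ivar x = s.ivar x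
  rvar : ∀ x < b, s'.rvar x = s.rvar x
  iarr : s'.iarr 1 = s.iarr 1

variable {s x v a i r l} {s' s'' : State} {b a' b' : ℕ}

theorem Keep.refl (a b : ℕ) (s : State) : Keep a b s s := ⟨fun _ _ => rfl, fun _ _ => rfl, rfl⟩

theorem Keep.trans (h : Keep a b s s') (h' : Keep a' b' s' s'') (ha : a ≤ a') (hb : b ≤ b') :
    Keep a b s s'' :=
  ⟨fun x hx => (h'.ivar x (hx.trans_le ha)).trans (h.ivar x hx),
    fun x hx => (h'.rvar x (hx.trans_le hb)).trans (h.rvar x hx), h'.iarr.trans h.iarr⟩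

theorem Keep.setI (h : Keep a b s s') (hx : a ≤ x) : Keep a b s (s'.setI x v) :=
  ⟨fun y hy => by rw [setI_ivar, Function.update_of_ne (by omega), h.ivar y hy], h.rvar, h.iarr⟩

theorem Keep.setR (h : Keep a b s s') (hx : b ≤ x) : Keep a b s (s'.setR x r) :=
  ⟨h.ivar, fun y hy => by rw [setR_rvar, Function.update_of_ne (by omega), h.rvar y hy], h.iarr⟩

theorem Keep.putR {c : ℕ} (h : Keep a b s s') : Keep a b s (s'.putR c i r) :=
  ⟨h.ivar, h.rvar, h.iarr⟩

theorem Keep.putList (h : Keep a b s s') : Keep a b s (s'.putList 0 l) :=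
  ⟨h.ivar, h.rvar, by simpa using h.iarr⟩

end StateLemmas

section Correctness

variable {n : ℕ}

theorem eval_lowTest (s : State) (x : ℕ) :
    (lowTest x).eval s ↔ (s.ivar x : ℝ) * (s.rvar 0 * s.rvar 0) ≤ 32 := by
  simp [lowTest, BExp.eval, RExp.eval, IExp.eval]

/-- The contribution of neighbor `b` to row `i` of the product with the column `w`. -/
noncomputable def entry (adj : ℕ → List ℕ) (ε : ℝ) (w : ℕ → ℝ) (i b : ℕ) : ℝ :=
  open Classical in
  if ((adj b).length : ℝ) * (ε * ε) ≤ 32 then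
    w b / Real.sqrt ((adj i).length * (adj b).length) else 0

theorem ends_rowLoop {adj : ℕ → List ℕ} {s : State} {i K : ℕ}
    (h8 : s.ivar 8 = (adj i).length) (hK : (adj i).length ≤ K)
    (hl : ∀ j < (adj i).length, s.iarr 0 j = (adj i).getD j 0) (h6 : s.rvar 6 = 0) :
    Ends n adj rowLoop s (40 * K + 40) fun s' => s'.rvar 6 =
      ∑ j ∈ Finset.range (adj i).length, entry adj (s.rvar 0) (s.rarr 1) i ((adj i).getD j 0) ∧
      s'.rarr = s.rarr ∧ Keep 9 6 s s' := by
  refine (Ends.forLoop (N := (adj i).length) (B := 30) (fun j s' => s'.ivar 9 = j ∧ s'.rvar 6 =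
      ∑ j ∈ Finset.range j, entry adj (s.rvar 0) (s.rarr 1) i ((adj i).getD j 0) ∧
      s'.rarr = s.rarr ∧ s'.iarr = s.iarr ∧ Keep 9 6 s s') ?_ ?_ ?_).mono ?_ ?_
  · exact ⟨by simp, by simp [h6], rfl, rfl, (Keep.refl _ _ _).setI le_rfl⟩
  · rintro j - s' ⟨h9, -, -, -, hk⟩
    simp [BExp.eval, IExp.eval, h9, hk.ivar 8 (by omega), h8]
  · rintro j hj s' ⟨h9, h6', hr, hi, hk⟩
    have hk8 := (hk.ivar 8 (by omega)).trans h8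
    have hk0 := hk.rvar 0 (by omega)
    refine (Ends.seq (Ends.iset (Ends.seq (Ends.degree (Ends.ite (B := 12) (fun hb => ?_)
      fun hb => ?_))))).mono ?_ fun _ h => h
    · refine (Ends.rset ?_).mono le_rfl fun _ h => h
      rw [eval_lowTest] at hb
      refine ⟨by simp [h9], by simp, ?_, hr, hi,
        (((hk.setI (by omega)).setI (by omega)).setR (by omega)).setI (by omega)⟩
      simp [IExp.eval, h9, hi, hl j hj, hk0] at hb
      simp [RExp.eval, IExp.eval, h9, h6', hr, hi, hl j hj, hk8, Finset.sum_range_succ, entry, hb]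
    · refine (Ends.skip ?_).mono (by omega) fun _ h => h
      rw [eval_lowTest] at hb
      refine ⟨by simp [h9], by simp, ?_, hr, hi,
        ((hk.setI (by omega)).setI (by omega)).setI (by omega)⟩
      simp [IExp.eval, h9, hi, hl j hj, hk0] at hb
      simp [h6', Finset.sum_range_succ, entry, hb]
    · decide
  · have : (BExp.ilt (.var 9) (.var 8)).cost = 3 := rfl
    rw [this]; omega
  · rintro s' ⟨-, h6', hr, -, hk⟩
    exact ⟨h6', hr, hk⟩

end Correctness

/-! ### The evaluation phase computes the sampled coefficients -/

section Correctness

variable {n : ℕ} {G : SimpleGraph (Fin n)} (L : AdjList G) (ε : ℝ)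

theorem lookup_coe (a : Fin n) : L.lookup a = (L.nbrs a).map Fin.val := by
  rw [AdjList.lookup, dif_pos a.2]

theorem length_lookup (a : Fin n) [Fintype (G.neighborSet a)] :
    (L.lookup a).length = G.degree a := by
  rw [lookup_coe, List.length_map, ← List.toFinset_card_of_nodup (L.nodup a),
    ← SimpleGraph.card_neighborFinset_eq_degree]
  congr 1
  ext b
  simp [L.mem_iff]

theorem sum_range_getD (l : List ℕ) (f : ℕ → ℝ) :
    ∑ j ∈ Finset.range l.length, f (l.getD j 0) = (l.map f).sum := by
  induction l with
  | nil => simp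
  | cons a l ih =>
    rw [List.length_cons, Finset.sum_range_succ', List.map_cons, List.sum_cons, ← ih, add_comm]
    simp

open Classical in
theorem sum_lookup (a : Fin n) (f : ℕ → ℝ) :
    ∑ j ∈ Finset.range (L.lookup a).length, f ((L.lookup a).getD j 0) =
      ∑ b : Fin n, if G.Adj a b then f b else 0 := by
  rw [sum_range_getD, lookup_coe, List.map_map, ← List.sum_toFinset _ (L.nodup a),
    ← Finset.sum_filter]
  refine Finset.sum_congr ?_ fun _ _ => rfl
  ext b
  simp [L.mem_iff]

/-- The vertices of degree at most `32 / ε²`. -/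
def LowDegree (a : Fin n) : Prop := ((L.lookup a).length : ℝ) * (ε * ε) ≤ 32

theorem sum_entry_eq {a : Fin n} (ha : LowDegree L ε a) (w : ℕ → ℝ) :
    ∑ j ∈ Finset.range (L.lookup a).length, entry L.lookup ε w a ((L.lookup a).getD j 0) =
      ∑ b : Fin n, cutoffAdjacency G (LowDegree L ε) a b * w b := by
  classical
  rw [sum_lookup L a fun b => entry L.lookup ε w a b]
  refine Finset.sum_congr rfl fun b _ => ?_
  rw [cutoffAdjacency, Matrix.of_apply, entry]
  by_cases hab : G.Adj a b
  · by_cases hb : LowDegree L ε b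
    · have hb' : ((L.lookup b).length : ℝ) * (ε * ε) ≤ 32 := hb
      rw [if_pos hab, if_pos hb', if_pos ⟨hab, ha, hb⟩, length_lookup, length_lookup]
      ring
    · have hb' : ¬ ((L.lookup b).length : ℝ) * (ε * ε) ≤ 32 := hb
      rw [if_pos hab, if_neg hb', if_neg fun h => hb h.2.2, zero_mul]
  · simp [hab]

theorem sum_cutoffAdjacency_of_not_lowDegree {a : Fin n} (ha : ¬ LowDegree L ε a)
    (w : ℕ → ℝ) : ∑ b : Fin n, cutoffAdjacency G (LowDegree L ε) a b * w b = 0 := by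
  refine Finset.sum_eq_zero fun b _ => ?_
  rw [cutoffAdjacency, Matrix.of_apply, if_neg fun h => ha h.2.1, zero_mul]

variable {L ε} {K N l : ℕ} {s : State}

/-- The degree is tested before the neighbors are read, so the cost is governed by the bound `K` on
low degrees, however large the maximum degree of the graph is. -/
theorem ends_rowCmd (hK : ∀ a, LowDegree L ε a → (L.lookup a).length ≤ K) {a : Fin n}
    (h7 : s.ivar 7 = a) (hε : s.rvar 0 = ε) :
    Ends n L.lookup rowCmd s (50 * K + 80) fun s' => s'.rvar 6 =
      ∑ b : Fin n, cutoffAdjacency G (LowDegree L ε) a b * s.rarr 1 b ∧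
      s'.rarr = s.rarr ∧ Keep 8 6 s s' := by
  refine (Ends.seq (Ends.rset (Ends.seq (Ends.degree (Ends.ite (B := 41 * K + 43) (fun hb => ?_)
    fun hb => ?_))))).mono ?_ fun _ h => h
  · have ha : LowDegree L ε a := by
      rw [eval_lowTest] at hb
      simpa [LowDegree, IExp.eval, h7, hε] using hb
    have hKa := hK a ha
    have hev : ∀ s' : State, s'.ivar 7 = a → IExp.eval s' (.var 7) = a := fun s' h => h
    refine (Ends.seq (Ends.readNbrs (d := K) ?_ ((ends_rowLoop (i := a) (K := K) ?_ hKa ?_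
      ?_).mono le_rfl ?_))).mono ?_ fun _ h => h
    · simpa [IExp.eval, h7] using hKa
    · simp [IExp.eval, h7]
    · intro j hj
      simp [IExp.eval, h7, hj]
    · simp [RExp.eval]
    · rintro s' ⟨h6, hr, hk⟩
      refine ⟨?_, by simpa using hr, ?_⟩
      · rw [h6, ← sum_entry_eq L ε ha]
        simp [hε]
      · exact ((((Keep.refl 8 6 s).setR le_rfl).setI le_rfl).putList).trans hk (by omega) le_rfl
    · simp only [IExp.cost]; omega
  · have ha : ¬ LowDegree L ε a := by
      rw [eval_lowTest] at hb
      simpa [LowDegree, IExp.eval, h7, hε] using hb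
    refine (Ends.skip ?_).mono (by omega) fun _ h => h
    refine ⟨?_, rfl, ((Keep.refl 8 6 s).setR le_rfl).setI le_rfl⟩
    rw [sum_cutoffAdjacency_of_not_lowDegree L ε ha]
    simp [RExp.eval]
  · have : (lowTest 8).cost = 9 := rfl
    rw [this]
    simp only [IExp.cost, RExp.cost]
    omega

theorem ends_nextCmd (hK : ∀ a, LowDegree L ε a → (L.lookup a).length ≤ K)
    (h0 : s.ivar 0 = n) (hε : s.rvar 0 = ε) :
    Ends n L.lookup nextCmd s (n * (50 * K + 100) + 7) fun s' =>
      (∀ a : Fin n, s'.rarr 3 a =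
        s.rvar 5 * ∑ b : Fin n, cutoffAdjacency G (LowDegree L ε) a b * s.rarr 1 b -
          s.rarr 2 a) ∧
      s'.rarr 0 = s.rarr 0 ∧ s'.rarr 1 = s.rarr 1 ∧ s'.rarr 2 = s.rarr 2 ∧ Keep 7 6 s s' := by
  refine (Ends.forLoop (N := n) (B := 50 * K + 91) (fun i s' => s'.ivar 7 = i ∧
      (∀ a : Fin n, (a : ℕ) < i → s'.rarr 3 a =
        s.rvar 5 * ∑ b : Fin n, cutoffAdjacency G (LowDegree L ε) a b * s.rarr 1 b -
          s.rarr 2 a) ∧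
      s'.rarr 0 = s.rarr 0 ∧ s'.rarr 1 = s.rarr 1 ∧ s'.rarr 2 = s.rarr 2 ∧ Keep 7 6 s s')
      ?_ ?_ ?_).mono ?_ ?_
  · exact ⟨by simp, by simp, rfl, rfl, rfl, (Keep.refl _ _ _).setI le_rfl⟩
  · rintro i - s' ⟨h7, -, -, -, -, hk⟩
    simp [BExp.eval, IExp.eval, h7, hk.ivar 0 (by omega), h0]
  · rintro i hi s' ⟨h7, h3, hr0, hr1, hr2, hk⟩
    refine (Ends.seq ((ends_rowCmd hK (a := ⟨i, hi⟩) h7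
      ((hk.rvar 0 (by omega)).trans hε)).mono le_rfl ?_) (B' := 10)).mono le_rfl fun _ h => h
    rintro s'' ⟨h6, hr, hk'⟩
    have hk'' : Keep 7 6 s s'' := hk.trans hk' (by omega) le_rfl
    have h7' : s''.ivar 7 = i := (hk'.ivar 7 (by omega)).trans h7
    refine (Ends.rput ?_).mono (by decide) fun _ h => h
    refine ⟨by simp [h7'], by simp, ?_, by simp [hr, hr0], by simp [hr, hr1], by simp [hr, hr2],
      hk''.putR.setI le_rfl⟩
    intro a ha
    rcases Nat.lt_succ_iff_lt_or_eq.1 ha with h | h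
    · simp [IExp.eval, h7', h.ne, hr, h3 a h]
    · obtain rfl : a = ⟨i, hi⟩ := Fin.ext h
      simp [IExp.eval, RExp.eval, h7', h6, hr, hr1, hr2, hk''.rvar 5 (by omega)]
  · have : (BExp.ilt (.var 7) (.var 0)).cost = 3 := rfl
    rw [this]; ring_nf; omega
  · rintro s' ⟨-, h3, hr0, hr1, hr2, hk⟩
    exact ⟨fun a => h3 a a.2, hr0, hr1, hr2, hk⟩

theorem ends_shiftCmd {adj : ℕ → List ℕ} (h0 : s.ivar 0 = n) :
    Ends n adj shiftCmd s (n * 30 + 7) fun s' =>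
      (∀ a < n, s'.rarr 1 a = s.rarr 3 a) ∧ (∀ a < n, s'.rarr 2 a = s.rarr 1 a) ∧
      s'.rarr 0 = s.rarr 0 ∧ Keep 7 6 s s' := by
  refine (Ends.forLoop (N := n) (B := 20) (fun i s' => s'.ivar 7 = i ∧
      (∀ a < i, s'.rarr 1 a = s.rarr 3 a) ∧ (∀ a, i ≤ a → s'.rarr 1 a = s.rarr 1 a) ∧
      (∀ a < i, s'.rarr 2 a = s.rarr 1 a) ∧
      s'.rarr 0 = s.rarr 0 ∧ s'.rarr 3 = s.rarr 3 ∧ Keep 7 6 s s') ?_ ?_ ?_).mono ?_ ?_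
  · exact ⟨by simp, by simp, by simp, by simp, rfl, rfl, (Keep.refl _ _ _).setI le_rfl⟩
  · rintro i - s' ⟨h7, -, -, -, -, -, hk⟩
    simp [BExp.eval, IExp.eval, h7, hk.ivar 0 (by omega), h0]
  · rintro i hi s' ⟨h7, h1, h1', h2, hr0, hr3, hk⟩
    refine (Ends.seq (Ends.rput (Ends.rput ?_))).mono (by decide) fun _ h => h
    refine ⟨by simp [h7], by simp, ?_, ?_, ?_, by simp [hr0], by simp [hr3],
      hk.putR.putR.setI le_rfl⟩
    · intro a ha
      rcases Nat.lt_succ_iff_lt_or_eq.1 ha with h | rfl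
      · simp [IExp.eval, h7, h.ne, h1 a h]
      · simp [IExp.eval, RExp.eval, h7, hr3]
    · intro a ha
      simp [IExp.eval, h7, show a ≠ i by omega, h1' a (by omega)]
    · intro a ha
      rcases Nat.lt_succ_iff_lt_or_eq.1 ha with h | rfl
      · simp [IExp.eval, h7, h.ne, h2 a h]
      · simp [IExp.eval, RExp.eval, h7, h1' a le_rfl]
  · have : (BExp.ilt (.var 7) (.var 0)).cost = 3 := rfl
    rw [this]; omega
  · rintro s' ⟨-, h1, -, h2, hr0, -, hk⟩
    exact ⟨h1, h2, hr0, hk⟩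

theorem ends_clearCmd {adj : ℕ → List ℕ} (h0 : s.ivar 0 = n) :
    Ends n adj clearCmd s (n * 30 + 7) fun s' =>
      (∀ a < n, s'.rarr 1 a = 0) ∧ (∀ a < n, s'.rarr 2 a = 0) ∧
      s'.rarr 0 = s.rarr 0 ∧ Keep 5 5 s s' := by
  refine (Ends.forLoop (N := n) (B := 20) (fun i s' => s'.ivar 5 = i ∧
      (∀ a < i, s'.rarr 1 a = 0) ∧ (∀ a < i, s'.rarr 2 a = 0) ∧
      s'.rarr 0 = s.rarr 0 ∧ Keep 5 5 s s') ?_ ?_ ?_).mono ?_ ?_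
  · exact ⟨by simp, by simp, by simp, rfl, (Keep.refl _ _ _).setI le_rfl⟩
  · rintro i - s' ⟨h5, -, -, -, hk⟩
    simp [BExp.eval, IExp.eval, h5, hk.ivar 0 (by omega), h0]
  · rintro i hi s' ⟨h5, h1, h2, hr0, hk⟩
    refine (Ends.seq (Ends.rput (Ends.rput ?_))).mono (by decide) fun _ h => h
    refine ⟨by simp [h5], by simp, ?_, ?_, by simp [hr0], hk.putR.putR.setI le_rfl⟩
    · intro a ha
      rcases Nat.lt_succ_iff_lt_or_eq.1 ha with h | rfl
      · simp [IExp.eval, h5, h.ne, h1 a h]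
      · simp [IExp.eval, RExp.eval, h5]
    · intro a ha
      rcases Nat.lt_succ_iff_lt_or_eq.1 ha with h | rfl
      · simp [IExp.eval, h5, h.ne, h2 a h]
      · simp [IExp.eval, RExp.eval, h5]
  · have : (BExp.ilt (.var 5) (.var 0)).cost = 3 := rfl
    rw [this]; omega
  · rintro s' ⟨-, h1, h2, hr0, hk⟩
    exact ⟨h1, h2, hr0, hk⟩

/-- The time for one product with the truncated matrix. -/
def columnTime (n K : ℕ) : ℕ := n * (50 * K + 130) + 60

/-- Real variable `5` plays two roles: it is the weight `1, 2, 2, …` of the current moment and the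
multiplier in the recurrence. Multiplier `1` and a zero previous column make the general update
produce the column of `T_1` from that of `T_0`; afterwards the multiplier is `2`. -/
theorem ends_momentLoop (hK : ∀ a, LowDegree L ε a → (L.lookup a).length ≤ K)
    (h0 : s.ivar 0 = n) (h1 : s.ivar 1 = N) (h2 : s.ivar 2 = l) {v : Fin n}
    (h4 : s.ivar 4 = v) (hε : s.rvar 0 = ε) (hN : s.rvar 2 = N) (h5 : s.rvar 5 = 1)
    (hcur : ∀ a : Fin n, s.rarr 1 a = if a = v then 1 else 0)
    (hprev : ∀ a : Fin n, s.rarr 2 a = 0) :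
    Ends n L.lookup momentLoop s (N * columnTime n K + 7) fun s' =>
      (∀ k < N, s'.rarr 0 k = s.rarr 0 k +
        fejerCoeff N k * chebDiag G (LowDegree L ε) k v / l) ∧ Keep 5 5 s s' := by
  refine (Ends.forLoop (N := N) (B := n * (50 * K + 130) + 50) (fun k s' => s'.ivar 6 = k ∧
      s'.rvar 5 = chebWeight k ∧
      (∀ a : Fin n, s'.rarr 1 a = chebColumn G (LowDegree L ε) v k a) ∧
      (∀ a : Fin n, s'.rarr 2 a =
        if k = 0 then 0 else chebColumn G (LowDegree L ε) v (k - 1) a) ∧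
      (∀ k' < k, s'.rarr 0 k' = s.rarr 0 k' +
        fejerCoeff N k' * chebDiag G (LowDegree L ε) k' v / l) ∧
      (∀ k', k ≤ k' → s'.rarr 0 k' = s.rarr 0 k') ∧ Keep 5 5 s s') ?_ ?_ ?_).mono ?_ ?_
  · refine ⟨by simp, by simp [chebWeight, h5], ?_, by simp [hprev], by simp, by simp,
      (Keep.refl _ _ _).setI (by omega)⟩
    intro a; simp [hcur, chebColumn]
  · rintro k - s' ⟨h6, -, -, -, -, -, hk⟩
    simp [BExp.eval, IExp.eval, h6, hk.ivar 1 (by omega), h1]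
  · rintro k hkN s' ⟨h6, h5', hc, hp, hlt, hge, hk⟩
    refine (Ends.seq (Ends.rput (Ends.seq ((ends_nextCmd hK ?_ ?_).mono le_rfl ?_)
      (B' := n * 30 + 12)))).mono ?_ fun _ h => h
    · simp [hk.ivar 0 (by omega), h0]
    · simp [hk.rvar 0 (by omega), hε]
    swap
    · simp only [IExp.cost, RExp.cost]; ring_nf; omega
    rintro s₁ ⟨hr3, hr0, hr1, hr2, hk1⟩
    have hkk1 : Keep 5 5 s s₁ := hk.putR.trans hk1 (by omega) (by omega)
    refine (Ends.seq ((ends_shiftCmd ?_).mono le_rfl ?_) (B' := 4)).mono (by omega) fun _ h => h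
    · exact (hkk1.ivar 0 (by omega)).trans h0
    rintro s₂ ⟨hs1, hs2, hs0, hk2⟩
    have hk12 : Keep 7 6 _ s₂ := hk1.trans hk2 le_rfl le_rfl
    have h62 : s₂.ivar 6 = k := by simp [hk12.ivar 6 (by omega), h6]
    refine (Ends.rset ?_).mono (by decide) fun _ h => h
    refine ⟨by simp [h62], by simp, by simp [RExp.eval, chebWeight], ?_, ?_, ?_, ?_,
      ((hkk1.trans hk2 (by omega) (by omega)).setR (by omega)).setI (by omega)⟩
    · intro a
      simp only [setI_rarr, setR_rarr]
      rw [hs1 a a.2, hr3]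
      simp only [putR_rvar, putR_rarr, h5']
      rw [Function.update_of_ne (by decide), Function.update_of_ne (by decide), hp]
      simp_rw [hc]
      cases k with
      | zero => simp [chebWeight, chebColumn]
      | succ k => simp [chebWeight, chebColumn]
    · intro a
      simp only [setI_rarr, setR_rarr]
      rw [hs2 a a.2, hr1]
      simp [hc]
    · intro k' hk'
      simp only [setI_rarr, setR_rarr]
      rw [hs0, hr0]
      rcases Nat.lt_succ_iff_lt_or_eq.1 hk' with h | rfl
      · simp [IExp.eval, h6, h.ne, hlt k' h]
      · simp [IExp.eval, RExp.eval, h6, hge k' le_rfl, h5', hk.ivar 4 (by omega), h4,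
          hk.rvar 2 (by omega), hN, hk.ivar 2 (by omega), h2, hc, fejerCoeff, chebDiag]
    · intro k' hk'
      simp only [setI_rarr, setR_rarr]
      rw [hs0, hr0]
      simp [IExp.eval, h6, show k' ≠ k by omega, hge k' (by omega)]
  · have : (BExp.ilt (.var 6) (.var 1)).cost = 3 := rfl
    rw [this]
    have : 3 + (n * (50 * K + 130) + 50) + 6 ≤ columnTime n K := by
      unfold columnTime; omega
    rw [add_assoc]
    exact Nat.add_le_add_right (Nat.mul_le_mul_left N this) 7
  · rintro s' ⟨-, -, -, -, h, -, hk⟩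
    exact ⟨h, hk⟩

/-- Each sample adds its contribution already damped and divided by `l`, so an output array that
starts at zero ends as the coefficient list without a final pass. -/
theorem ends_evalCmd (hK : ∀ a, LowDegree L ε a → (L.lookup a).length ≤ K)
    (h0 : s.ivar 0 = n) (h1 : s.ivar 1 = N) (h2 : s.ivar 2 = l) {v : ℕ → Fin n}
    (hv : ∀ j < l, s.iarr 1 j = v j) (hε : s.rvar 0 = ε) (hN : s.rvar 2 = N)
    (hout : ∀ k, s.rarr 0 k = 0) :
    Ends n L.lookup evalCmd s (l * (N * columnTime n K + n * 30 + 60) + 20) fun s' =>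
      s'.output = chebyshevDensity N (sampleCoeff G (LowDegree L ε) N l v) := by
  refine (Ends.seq ((Ends.forLoop (N := l) (B := N * columnTime n K + n * 30 + 50)
      (fun j s' => s'.ivar 3 = j ∧
      (∀ k < N, s'.rarr 0 k = ∑ i ∈ Finset.range j,
        fejerCoeff N k * chebDiag G (LowDegree L ε) k (v i) / l) ∧ Keep 3 5 s s')
      ?_ ?_ ?_).mono le_rfl ?_) (B' := 10)).mono ?_ fun _ h => h
  · exact ⟨by simp, by simp [hout], (Keep.refl _ _ _).setI le_rfl⟩
  · rintro j - s' ⟨h3, -, hk⟩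
    simp [BExp.eval, IExp.eval, h3, hk.ivar 2 (by omega), h2]
  · rintro j hj s' ⟨h3, hr, hk⟩
    have hiarr : s'.iarr 1 j = v j := by rw [hk.iarr, hv j hj]
    refine (Ends.seq (Ends.iset (Ends.seq ((ends_clearCmd ?_).mono le_rfl ?_)
      (B' := N * columnTime n K + 30)))).mono ?_ fun _ h => h
    · simp [hk.ivar 0 (by omega), h0]
    swap
    · simp only [IExp.cost]; omega
    rintro s₁ ⟨hc1, hc2, hc0, hk1⟩
    have h41 : s₁.ivar 4 = v j := by
      rw [hk1.ivar 4 (by omega)]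
      simp [IExp.eval, h3, hiarr]
    have hk1' : Keep 4 5 s' s₁ :=
      ((Keep.refl 4 5 s').setI le_rfl).trans hk1 (by omega) le_rfl
    have hk1s : Keep 3 5 s s₁ := hk.trans hk1' (by omega) le_rfl
    refine (Ends.seq (Ends.rput (Ends.seq (Ends.rset ((ends_momentLoop (N := N) (l := l) (v := v j)
      hK ?_ ?_ ?_ ?_ ?_ ?_ ?_ ?_ ?_).mono le_rfl ?_))))).mono ?_ fun _ h => h
    · simp [hk1s.ivar 0 (by omega), h0]
    · simp [hk1s.ivar 1 (by omega), h1]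
    · simp [hk1s.ivar 2 (by omega), h2]
    · simp [h41]
    · simp [hk1s.rvar 0 (by omega), hε]
    · simp [hk1s.rvar 2 (by omega), hN]
    · simp [RExp.eval]
    · intro a
      by_cases h : a = v j
      · simp [IExp.eval, RExp.eval, h41, h]
      · have h' : (a : ℕ) ≠ v j := fun e => h (Fin.ext e)
        simp [IExp.eval, h41, h, h', hc1 a a.2]
    · intro a; simp [hc2 a a.2]
    swap
    · simp only [IExp.cost, RExp.cost]; omega
    rintro s₂ ⟨hm, hk2⟩
    have hk2' : Keep 4 5 s' s₂ := hk1'.putR.setR (by omega) |>.trans hk2 (by omega) le_rfl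
    refine ⟨(hk2'.ivar 3 (by omega)).trans h3, by simp, ?_,
      (hk.trans hk2' (by omega) le_rfl).setI le_rfl⟩
    intro k hkN
    rw [setI_rarr, hm k hkN, Finset.sum_range_succ, ← hr k hkN]
    simp [hc0]
  · rintro s' ⟨-, hr, hk⟩
    -- Variable `0` holds `n` throughout the loops and is overwritten only now by the output length
    -- `N`.
    refine (Ends.iset ?_).mono (by decide) fun _ h => h
    unfold State.output
    simp only [setI_ivar, setI_rarr, Function.update_self, IExp.eval, hk.ivar 1 (by omega), h1]
    refine chebyshevDensity_congr fun k hkN => ?_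
    rw [hr k hkN, sampleCoeff, sampleMoment, ← Finset.sum_div, ← Finset.mul_sum, mul_div_assoc]
  · have : (BExp.ilt (.var 3) (.var 2)).cost = 3 := rfl
    rw [this]
    have : 3 + (N * columnTime n K + n * 30 + 50) + 6 ≤
      N * columnTime n K + n * 30 + 60 := by omega
    have := Nat.mul_le_mul_left l this
    linarith

end Correctness

/-! ## Parameters and sampling -/

section Sampling

variable {n : ℕ} {ε δ : ℝ} {N l : ℕ}

/-- The two hypotheses say that `N` is the least natural number with `N ε² ≥ 16`; the loop counter
finds it without rounding and then serves as `N`. -/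
theorem ends_initCmd {adj : ℕ → List ℕ} (hlt : ∀ i < N, i * (ε * ε) < 16)
    (hN : 16 ≤ N * (ε * ε)) :
    Ends n adj initCmd (initState n ε δ) (N * 20 + 60) fun s =>
      s.ivar 0 = n ∧ s.ivar 1 = N ∧ s.ivar 2 = 0 ∧ s.rvar 0 = ε ∧ s.rvar 1 = δ ∧ s.rvar 2 = N ∧
      s.rvar 3 = 1 + ε * ε / (256 * (N * N)) ∧ s.rvar 4 = 1 ∧ ∀ k, s.rarr 0 k = 0 := by
  refine (Ends.seq ((Ends.forLoop (N := N) (B := 1) (fun i s => s.ivar 1 = i ∧ s.ivar 0 = n ∧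
      s.ivar 2 = 0 ∧ s.rvar 0 = ε ∧ s.rvar 1 = δ ∧ ∀ k, s.rarr 0 k = 0) ?_ ?_ ?_).mono le_rfl
      ?_) (B' := 30)).mono ?_ fun _ h => h
  · simp [initState]
  · rintro i hi s ⟨h1, -, -, h0, -⟩
    simp only [BExp.eval, RExp.eval, IExp.eval, h1, h0]
    constructor
    · intro h
      by_contra hni
      obtain rfl : i = N := by omega
      push_cast at h
      linarith
    · intro h
      push_cast
      exact hlt i h
  · rintro i - s ⟨h1, h⟩
    exact Ends.skip ⟨h1, by simp, by simpa using h⟩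
  · rintro s ⟨h1, h0, h2, hr0, hr1, hr⟩
    refine (Ends.seq (Ends.rset (Ends.seq (Ends.rset (Ends.rset ?_))))).mono (by decide)
      fun _ h => h
    simp [RExp.eval, IExp.eval, h1, h0, h2, hr0, hr1, hr]
  · have : (BExp.rlt (.mul (.ofNat (.var 1)) (.mul (.var 0) (.var 0))) (.const 16)).cost = 8 :=
      rfl
    rw [this]; omega

/-- The effect of one round of the sampling loop. -/
noncomputable def drawEffect (s : State) (a : Fin n) : State :=
  (((s.setR 4 (s.rvar 4 * s.rvar 3)).setI 3 a).putI 1 (s.ivar 2) a).setI 2 (s.ivar 2 + 1)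

theorem run_drawCmd [NeZero n] {adj : ℕ → List ℕ} (K : List Cmd) (s : State) (t : ℕ) :
    run n adj ⟨drawCmd :: K, s, t⟩ 7 =
      (PMF.uniformOfFintype (Fin n)).map fun a => ⟨K, drawEffect s a, t + 15⟩ := by
  -- Three steps precede the random choice, one makes it and three follow.
  rw [show (7 : ℕ) = 3 + 1 + 3 from rfl, run_add, run_add]
  have h3 : run n adj ⟨drawCmd :: K, s, t⟩ 3 = PMF.pure ⟨.randVertex 3 ::
      .seq (.iput 1 (.var 2) (.var 3)) (.iset 2 (.add (.var 2) (.const 1))) :: K,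
      s.setR 4 (s.rvar 4 * s.rvar 3), t + 6⟩ := by
    simp [run, drawCmd, step, RExp.eval, RExp.cost]
  rw [h3, PMF.pure_bind, run_one, step, unif_range, PMF.map_comp, PMF.bind_map, PMF.map]
  congr 1
  funext a
  simp [run, step, drawEffect, IExp.eval, IExp.cost]

theorem iterState_drawEffect {s : State} (h2 : s.ivar 2 = 0) (h4 : s.rvar 4 = 1)
    (v : ℕ → Fin n) (j : ℕ) :
    (∀ x < 2, (iterState drawEffect s v j).ivar x = s.ivar x) ∧
    (iterState drawEffect s v j).ivar 2 = j ∧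
    (∀ x < 4, (iterState drawEffect s v j).rvar x = s.rvar x) ∧
    (iterState drawEffect s v j).rvar 4 = s.rvar 3 ^ j ∧
    (∀ i < j, (iterState drawEffect s v j).iarr 1 i = v i) ∧
    (iterState drawEffect s v j).rarr = s.rarr := by
  induction j with
  | zero => simp [iterState, h2, h4]
  | succ j ih =>
    obtain ⟨hi, hi2, hr, hr4, ha, hrr⟩ := ih
    refine ⟨fun x hx => ?_, ?_, fun x hx => ?_, ?_, fun i hij => ?_, ?_⟩
    · simp [iterState, drawEffect, show x ≠ 2 by omega, show x ≠ 3 by omega, hi x hx]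
    · simp [iterState, drawEffect, hi2]
    · simp [iterState, drawEffect, show x ≠ 4 by omega, hr x hx]
    · simp [iterState, drawEffect, hr4, hr 3 (by omega), pow_succ]
    · rcases Nat.lt_succ_iff_lt_or_eq.1 hij with h | rfl
      · simp [iterState, drawEffect, hi2, h.ne, ha i h]
      · simp [iterState, drawEffect, hi2]
    · simp [iterState, drawEffect, hrr]

variable {G : SimpleGraph (Fin n)} {L : AdjList G} {K : ℕ}

/-- The distribution of the outcomes of the program for given values of its parameters. -/
theorem program_spec [NeZero n] (hK : ∀ a, LowDegree L ε a → (L.lookup a).length ≤ K)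
    (hlt : ∀ i < N, i * (ε * ε) < 16) (hN : 16 ≤ N * (ε * ε))
    (hl : ∀ j < l, δ * (1 + ε * ε / (256 * (N * N))) ^ j < 2 * N)
    (hl' : 2 * N ≤ δ * (1 + ε * ε / (256 * (N * N))) ^ l) :
    expectedTime program L ε δ ≤
      ((N * 20 + l * 23 + l * (N * columnTime n K + n * 30 + 60) + 100 : ℕ) : ℝ≥0∞) ∧
    ∀ R : (ℝ → ℝ) → Prop, (draws n l).toOuterMeasure
      {v | R (chebyshevDensity N (sampleCoeff G (LowDegree L ε) N l v))} ≤
        outputProb program L ε δ R := by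
  obtain ⟨s, t, ht, ⟨m, -, hrun⟩, h0, h1, h2, hr0, hr1, hr2, hr3, hr4, hout⟩ :=
    ends_initCmd (n := n) (adj := L.lookup) (δ := δ) hlt hN
  have hb : ∀ j (v : ℕ → Fin n), drawTest.eval (iterState drawEffect s v j) ↔
      δ * (1 + ε * ε / (256 * (N * N))) ^ j < 2 * N := by
    intro j v
    obtain ⟨-, -, hr, hr4', -, -⟩ := iterState_drawEffect (n := n) h2 hr4 v j
    simp only [drawTest, BExp.eval, RExp.eval, hr 1 (by omega), hr 2 (by omega), hr4', hr1, hr2,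
      hr3]
    norm_num
  -- The summands count the outer sequencing, the initialization, the inner sequencing, `l` rounds
  -- of one test and seven body steps, and the final failing test. A round takes time `8` for the
  -- test and `15` for the body.
  have hexec : exec program L ε δ (1 + m + 1 + l * (1 + 7) + 1) = (draws n l).map fun v =>
      ⟨[evalCmd], iterState drawEffect s v l, 1 + t + 1 + l * 23 + 8⟩ := by
    have hcost : drawTest.cost = 7 := rfl
    unfold exec program
    rw [run_add, run_add, run_add, run_add, run_one, step, PMF.pure_bind, hrun, PMF.pure_bind,
      run_one, step, PMF.pure_bind, run_random_while drawEffect run_drawCmd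
        (fun j hj v => (hb j v).2 (hl j hj)), PMF.bind_map, PMF.map]
    congr 1
    funext v
    simp only [Function.comp_apply]
    rw [run_one, step, if_neg fun h => absurd ((hb l v).1 h) (not_lt.2 hl'), hcost]
  have key := expectedTime_le_and_le_outputProb (draws n l) hexec
    (Q := fun v q => q = chebyshevDensity N (sampleCoeff G (LowDegree L ε) N l v))
    (B := l * (N * columnTime n K + n * 30 + 60) + 20) fun v => by
      obtain ⟨hi, hi2, hr, -, ha, hrr⟩ := iterState_drawEffect h2 hr4 v l
      refine ends_evalCmd hK ?_ ?_ hi2 ha ?_ ?_ fun k => ?_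
      · rw [hi 0 (by omega), h0]
      · rw [hi 1 (by omega), h1]
      · rw [hr 0 (by omega), hr0]
      · rw [hr 2 (by omega), hr2]
      · rw [hrr, hout]
  refine ⟨key.1.trans ?_, fun R => le_trans (measure_mono fun v hv => ?_) (key.2 R)⟩
  · rw [Nat.cast_le]
    generalize l * (N * columnTime n K + n * 30 + 60) = z
    omega
  · rintro q rfl
    exact hv

end Sampling

/-! ## Estimates for the parameters -/

section Parameters

/-- This `l` is the number of rounds of the sampling loop: its minimality bounds the time, and the
threshold reached at `l` gives the accuracy. -/
theorem exists_pow_threshold {δ ρ M : ℝ} (hδ : 0 < δ) (hρ : 1 < ρ) (hM : δ < M) :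
    ∃ l : ℕ, 0 < l ∧ (∀ j < l, δ * ρ ^ j < M) ∧ M ≤ δ * ρ ^ l := by
  classical
  have hex : ∃ l : ℕ, M ≤ δ * ρ ^ l := by
    obtain ⟨l, h⟩ := pow_unbounded_of_one_lt (M / δ) hρ
    exact ⟨l, by rw [div_lt_iff₀ hδ] at h; linarith⟩
  refine ⟨Nat.find hex, ?_, fun j hj => not_le.1 (Nat.find_min hex hj), Nat.find_spec hex⟩
  -- At least one sample is needed, since the sample means divide by `l`.
  refine Nat.pos_of_ne_zero fun h => ?_
  have := Nat.find_spec hex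
  rw [h, pow_zero, mul_one] at this
  linarith

/-- Take logarithms at the last round `l - 1`, where the threshold is not yet reached, and use `log
(1 + y) ≥ y/(1 + y) ≥ y/2`. The crude `log M ≤ M` is enough for a polynomial bound. -/
theorem pow_threshold_le {δ y M : ℝ} (hδ : 0 < δ) (hy : 0 < y) (hy1 : y ≤ 1) (hM : 0 < M)
    {l : ℕ} (hpos : 0 < l) (hl : ∀ j < l, δ * (1 + y) ^ j < M) :
    (l : ℝ) ≤ 1 + 2 * (M + Real.log (1 / δ)) / y := by
  have hlog : y / 2 ≤ Real.log (1 + y) := by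
    refine le_trans ?_ (Real.one_sub_inv_le_log_of_pos (by linarith))
    have : 1 - (1 + y)⁻¹ = y / (1 + y) := by field_simp; ring
    rw [this]
    gcongr
    linarith
  have key : ∀ j < l, j * (y / 2) ≤ M + Real.log (1 / δ) := fun j hj => by
    have h := Real.log_le_log (by positivity) (hl j hj).le
    rw [Real.log_mul hδ.ne' (by positivity), Real.log_pow] at h
    have h1 := Real.log_le_self hM.le
    have h2 : (j : ℝ) * (y / 2) ≤ j * Real.log (1 + y) := by gcongr
    rw [one_div, Real.log_inv]
    linarith
  have h := key (l - 1) (by omega)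
  rw [Nat.cast_sub (by omega), Nat.cast_one] at h
  have : 2 * (M + Real.log (1 / δ)) / y = (M + Real.log (1 / δ)) / (y / 2) := by field_simp
  rw [this, ← sub_le_iff_le_add', le_div_iff₀ (by positivity)]
  exact h

end Parameters

/-! ### Running time and accuracy for the chosen parameters -/

section Bounds

/-- Here `X` stands for `(1 + log (1/δ))/ε`. The dominant cost is `l` samples times `N` matrix
products of cost `O(nK)` each, that is, `X^8 · X^2 · n X^2` up to a constant. -/
theorem time_bound_le {n N l K : ℕ} {X : ℝ} (hX : 1 ≤ X) (hn : 0 < n)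
    (hN : (N : ℝ) ≤ 17 * X ^ 2) (hK : (K : ℝ) ≤ 32 * X ^ 2)
    (hl : (l : ℝ) ≤ 6 * 10 ^ 6 * X ^ 8) :
    ((N * 20 + l * 23 + l * (N * columnTime n K + n * 30 + 60) + 100 : ℕ) : ℝ) ≤
      10 ^ 12 * n * X ^ 12 := by
  have hn' : (1 : ℝ) ≤ n := by exact_mod_cast hn
  have hX2 : 1 ≤ X ^ 2 := one_le_pow₀ hX
  have hX4 : 1 ≤ X ^ 4 := one_le_pow₀ hX
  have hcol : (columnTime n K : ℝ) ≤ n * (1790 * X ^ 2) := by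
    unfold columnTime
    push_cast
    calc (n : ℝ) * (50 * K + 130) + 60 ≤ n * (50 * (32 * X ^ 2) + 130 * X ^ 2) +
          n * (60 * X ^ 2) := by
          gcongr
          · linarith
          · nlinarith
      _ = _ := by ring
  have hinner : (N : ℝ) * columnTime n K + n * 30 + 60 ≤ n * (30520 * X ^ 4) := by
    calc (N : ℝ) * columnTime n K + n * 30 + 60 ≤
          (17 * X ^ 2) * (n * (1790 * X ^ 2)) + n * (30 * X ^ 4) + n * (60 * X ^ 4) := by
          gcongr
          · linarith
          · nlinarith
      _ = _ := by ring
  have hX12 : 1 ≤ X ^ 12 := one_le_pow₀ hX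
  have h2 : X ^ 2 ≤ X ^ 12 := pow_le_pow_right₀ hX (by norm_num)
  have h8 : X ^ 8 ≤ X ^ 12 := pow_le_pow_right₀ hX (by norm_num)
  have hnX : X ^ 12 ≤ n * X ^ 12 := le_mul_of_one_le_left (by positivity) hn'
  have hmain : (l : ℝ) * (N * columnTime n K + n * 30 + 60) ≤
      (6 * 10 ^ 6 * X ^ 8) * (n * (30520 * X ^ 4)) := by gcongr
  have hmain' : (6 * 10 ^ 6 * X ^ 8) * (n * (30520 * X ^ 4)) =
      183120000000 * (n * X ^ 12) := by ring
  push_cast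
  linarith

theorem length_lookup_le {n : ℕ} {G : SimpleGraph (Fin n)} {L : AdjList G} {ε : ℝ} (hε : 0 < ε)
    (a : Fin n) (ha : LowDegree L ε a) : (L.lookup a).length ≤ ⌊32 / (ε * ε)⌋₊ := by
  refine Nat.le_floor ?_
  rw [le_div_iff₀ (by positivity)]
  exact ha

theorem W1_lowDegree_le {n : ℕ} (hn : 0 < n) {G : SimpleGraph (Fin n)}
    (hG : ∀ v, ∃ w, G.Adj v w) (L : AdjList G) {ε : ℝ} (hε : 0 < ε) {N l : ℕ} (hN2 : 2 < N)
    (hN : 16 ≤ N * (ε * ε)) (hl : 0 < l) (v : ℕ → Fin n)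
    (hclose : ∀ k < N, |sampleMoment G (LowDegree L ε) l v k -
      meanMoment G (LowDegree L ε) k| ≤ ε / (4 * N)) :
    W1 (densityMeasure (chebyshevDensity N (sampleCoeff G (LowDegree L ε) N l v)))
      (spectralMeasure (normalizedLaplacian_isHermitian G)) ≤ ENNReal.ofReal ε := by
  have hfrob := sum_sq_normalizedLaplacian_sub_cutoffLaplacian_le G (LowDegree L ε)
    (κ := ε * ε / 32) (by positivity) hG fun a _ ha => by
      have ha' : ¬ ((L.lookup a).length : ℝ) * (ε * ε) ≤ 32 := ha
      rw [length_lookup] at ha'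
      linarith
  -- The error budget is `ε/2` for the moments and `ε/4` each for smoothing and truncation; the
  -- degree threshold `32/ε²` gives a squared Frobenius error of at most `n · 2κ = n (ε/4)²`.
  have h := W1_sampleCoeff_le G (LowDegree L ε) hn hN2 hl v (η := ε / (4 * N)) (t := ε / 4)
    (by positivity) (by nlinarith) hclose (hfrob.trans (le_of_eq (by ring)))
  have hN' : (N : ℝ) ≠ 0 := by positivity
  have : 2 * N * (ε / (4 * N)) + 2 * (ε / 4) = ε := by field_simp; ring
  rwa [this] at h

end Bounds

end RAM

end SDE

/-! ### Choice of the parameters and conclusion -/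

theorem mainTheorem6 :
    ∃ (P : SDE.RAM.Cmd) (C : ℝ) (k : ℕ),
      ∀ (n : ℕ) (_ : 0 < n) (G : SimpleGraph (Fin n)) (_ : ∀ v, ∃ w, G.Adj v w)
        (L : SDE.AdjList G) (ε δ : ℝ) (_ : 0 < ε) (_ : ε < 1) (_ : 0 < δ) (_ : δ < 1),
        SDE.RAM.expectedTime P L ε δ ≤
            ENNReal.ofReal (C * n * ((1 + Real.log (1 / δ)) / ε) ^ k) ∧
        SDE.RAM.outputProb P L ε δ SDE.IsDensity = 1 ∧
        ENNReal.ofReal (1 - δ) ≤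
          SDE.RAM.outputProb P L ε δ (fun q =>
            SDE.IsDensity q ∧
            SDE.W1 (SDE.densityMeasure q)
              (SDE.spectralMeasure (SDE.normalizedLaplacian_isHermitian G)) ≤
                ENNReal.ofReal ε) := by
  refine ⟨SDE.RAM.program, 10 ^ 12, 12, fun n hn G hG L ε δ hε hε1 hδ hδ1 => ?_⟩
  have : NeZero n := ⟨hn.ne'⟩
  have hεε : 0 < ε * ε := by positivity
  have hεε1 : ε * ε ≤ 1 := by nlinarith
  -- Chosen so that the smoothing error `1/√N` is at most `ε/4`.
  set N : ℕ := ⌈16 / (ε * ε)⌉₊ with hNdef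
  have hN : 16 ≤ N * (ε * ε) := by
    rw [← div_le_iff₀ hεε]; exact Nat.le_ceil _
  have hlt : ∀ i < N, (i : ℝ) * (ε * ε) < 16 := fun i hi => by
    rw [← lt_div_iff₀ hεε]; exact Nat.lt_ceil.1 hi
  have hN16 : (16 : ℝ) ≤ N := hN.trans (mul_le_of_le_one_right (by positivity) hεε1)
  have hN2 : 2 < N := by
    have : (2 : ℝ) < N := by linarith
    exact_mod_cast this
  -- This is `η²/16` for `η = ε/(4N)`, the exponent gained per sample in the tail bound.
  set y : ℝ := ε * ε / (256 * (N * N)) with hy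
  have hy0 : 0 < y := by positivity
  have hy1 : y ≤ 1 := by
    rw [hy, div_le_one (by positivity)]; nlinarith
  obtain ⟨l, hl0, hl, hl'⟩ := SDE.RAM.exists_pow_threshold (ρ := 1 + y) (M := 2 * N) hδ
    (by linarith) (by linarith)
  obtain ⟨htime, hprob⟩ := SDE.RAM.program_spec (n := n) (δ := δ)
    (SDE.RAM.length_lookup_le (L := L) hε) hlt hN hl hl'
  have hdens : ∀ v : ℕ → Fin n, SDE.IsDensity (SDE.chebyshevDensity N
      (SDE.sampleCoeff G (SDE.RAM.LowDegree L ε) N l v)) := fun v =>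
    SDE.isDensity_sampleCoeff G _ (by omega) hl0 v
  refine ⟨htime.trans ?_, le_antisymm SDE.RAM.outputProb_le_one ?_, ?_⟩
  · rw [← ENNReal.ofReal_natCast]
    refine ENNReal.ofReal_le_ofReal ?_
    have hlog : 0 ≤ Real.log (1 / δ) :=
      Real.log_nonneg (by rw [one_div]; exact (one_le_inv₀ hδ).2 hδ1.le)
    set X := (1 + Real.log (1 / δ)) / ε with hX
    have hlogX : 1 + Real.log (1 / δ) ≤ X := by
      rw [hX, le_div_iff₀ hε]
      exact mul_le_of_le_one_right (by linarith) hε1.le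
    have hX1 : 1 ≤ X := by linarith
    have hεX : 1 / ε ≤ X := by
      rw [hX]; gcongr; linarith
    have hεX2 : 1 / (ε * ε) ≤ X ^ 2 := by
      calc 1 / (ε * ε) = (1 / ε) ^ 2 := by field_simp
        _ ≤ X ^ 2 := by gcongr
    have hX2 : 1 ≤ X ^ 2 := one_le_pow₀ hX1
    have hNX : (N : ℝ) ≤ 17 * X ^ 2 := by
      have h1 : (N : ℝ) < 16 / (ε * ε) + 1 := Nat.ceil_lt_add_one (by positivity)
      have h2 : 16 / (ε * ε) = 16 * (1 / (ε * ε)) := by ring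
      linarith
    refine SDE.RAM.time_bound_le hX1 hn hNX ?_ ?_
    · have h1 : (⌊32 / (ε * ε)⌋₊ : ℝ) ≤ 32 / (ε * ε) := Nat.floor_le (by positivity)
      have h2 : 32 / (ε * ε) = 32 * (1 / (ε * ε)) := by ring
      linarith
    · have h := SDE.RAM.pow_threshold_le hδ hy0 hy1 (by positivity) hl0 hl
      have hXX : X ≤ X ^ 2 := by nlinarith
      calc (l : ℝ) ≤ 1 + 2 * (2 * N + Real.log (1 / δ)) / y := h
        _ = 1 + 512 * (2 * N + Real.log (1 / δ)) * (N * N) * (1 / (ε * ε)) := by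
            rw [hy]; field_simp; ring
        _ ≤ X ^ 8 + 512 * (2 * (17 * X ^ 2) + X ^ 2) * ((17 * X ^ 2) * (17 * X ^ 2)) * X ^ 2 := by
            gcongr
            · exact one_le_pow₀ hX1
            · linarith
        _ = 5178881 * X ^ 8 := by ring
        _ ≤ 6 * 10 ^ 6 * X ^ 8 := by gcongr; norm_num
  -- Every sequence of draws yields a density, so this event is certain.
  · refine le_trans (le_of_eq ?_) (hprob _)
    exact ((PMF.toOuterMeasure_apply_eq_one_iff _ _).2 fun v _ => hdens v).symm
  · refine le_trans ?_ (hprob _)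
    have hconc := SDE.draws_uniform_tail (n := n) (N := N) (l := l) (δ := δ)
      (X := SDE.chebDiag G (SDE.RAM.LowDegree L ε)) (η := ε / (4 * N))
      (SDE.abs_chebDiag_le_one G _) (by positivity) (by
        rw [div_le_one (by positivity)]; linarith) hl0 (by
        have h1 : (ε / (4 * N)) ^ 2 / 16 = y := by rw [hy]; field_simp; ring
        -- The stopping rule `2N ≤ δ (1 + y)^l` thus implies `2N exp(-l y) ≤ δ`, which is the
        -- failure probability allowed in the union bound.
        have h2 : (1 + y) ^ l ≤ Real.exp (l * y) := by
          rw [Real.exp_nat_mul]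
          gcongr
          rw [add_comm]; exact Real.add_one_le_exp y
        rw [h1, Real.exp_neg, ← div_eq_mul_inv, div_le_iff₀ (Real.exp_pos _)]
        exact hl'.trans (by gcongr))
    refine hconc.trans (MeasureTheory.measure_mono fun v hv => ⟨hdens v, ?_⟩)
    exact SDE.RAM.W1_lowDegree_le hn hG L hε hN2 hN hl0 v hv
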